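/- Let $\mathbb D$ be the open unit disk and $dA(z)=\pi^{-1}\,dx\,dy$. For a bounded domain $\Omega\subset\mathbb C$ put $\delta(w)=\operatorname{dist}(w,\partial\Omega)$ and, for $0<\kappa<1$, let $$I_{\kappa}(z)=\int_\Omega\frac{\delta(w)^\kappa}{|z-w|^{2+\kappa}+\delta(w)^{2+\kappa}}\,dA(w),\qquad z\in\Omega,$$ be its Marcinkiewicz–Zygmund integral. For a bounded univalent (injective holomorphic) function $\varphi:\mathbb D\to\mathbb C$ put $$\widetilde{\mathfrak C}_\varphi[f](z)=\int_{\mathbb D}\frac{\varphi'(w)}{\varphi(w)-\varphi(z)}\,\frac{\bar z-\bar w}{1-\bar w z}\,f(w)\,dA(w),\qquad z\in\mathbb D,$$ and let $\mathbf B_\kappa$ be the unit ball of the space $\mathcal L_\kappa(\mathbb D)=L^{(2+\kappa)/(1+\kappa)}\big(\mathbb D,(1-|z|^2)^{-\kappa/(1+\kappa)}\,dA(z)\big)$ with norm $$\|f\|_{\mathcal L_\kappa(\mathbb D)}=\Big(\int_{\mathbb D}|f(z)|^{(2+\kappa)/(1+\kappa)}(1-|z|^2)^{-\kappa/(1+\kappa)}\,dA(z)\Big)^{(1+\kappa)/(2+\kappa)}.$$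 **Lemma 4.1.** There is an absolute constant $\gamma_0>0$ such that, first, for every $0<\kappa<1$, every bounded domain $\Omega\subset\mathbb C$ and every real $c<\gamma_0\kappa$, the integral $I_\kappa(z)$ converges for all $z\in\Omega$ and $\int_\Omega \exp[c\,I_\kappa(z)]\,dA(z)<+\infty$; and, second, for every $0<\kappa<1$ and every bounded univalent function $\varphi$ on $\mathbb D$ the following holds. For every $f\in\mathcal L_\kappa(\mathbb D)$ and every $z\in\mathbb D$ the integral defining $\widetilde{\mathfrak C}_\varphi[f](z)$ converges absolutely, $\sup_{f\in\mathbf B_\kappa}|\widetilde{\mathfrak C}_\varphi[f](z)|^{2+\kappa}<+\infty$ for every $z\in\mathbb D$, and for every $\varepsilon>0$ and every $\gamma$ with $0<\gamma<\gamma_1=4^{-\kappa}(1+\varepsilon)^{-1}\gamma_0$, $$\int_{\mathbb D}\exp\Big\{\gamma\kappa\sup_{f\in\mathbf B_\kappa}\big|\widetilde{\mathfrak C}_\varphi[f](z)\big|^{2+\kappa}\Big\}\,|\varphi'(z)|^2\,dA(z)<+\infty .$$ -/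

import Mathlib

open MeasureTheory Set Metric

noncomputable section

namespace MZSobolev

/-- The open unit disk in the complex plane. -/
def disk : Set ℂ := ball 0 1

/-- Normalized area measure `dA = π⁻¹ dx dy` on the complex plane. -/
def area : Measure ℂ := ENNReal.ofReal (Real.pi⁻¹) • (volume : Measure ℂ)

/-- Bounded univalent functions on the disk: conformal maps of the disk onto bounded domains.
No normalization at the origin is imposed. -/
structure IsBoundedUnivalent (φ : ℂ → ℂ) : Prop where
  holo : DifferentiableOn ℂ φ disk
  inj : InjOn φ disk
  bdd : Bornology.IsBounded (φ '' disk)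

/-- The integrand of the transform of `f`, as a function of `w`:
`φ'(w) / (φ(w) - φ(z)) * (z̄ - w̄) / (1 - w̄ z) * f(w)`.
(The point `w = z`, where the quotient is undefined, is negligible.) -/
def cauchyIntegrand (φ f : ℂ → ℂ) (z w : ℂ) : ℂ :=
  deriv φ w / (φ w - φ z) *
    ((starRingEnd ℂ z - starRingEnd ℂ w) / (1 - starRingEnd ℂ w * z)) * f w

/-- The transferred Cauchy-type transform. -/
def cauchyTilde (φ f : ℂ → ℂ) (z : ℂ) : ℂ :=
  ∫ w in disk, cauchyIntegrand φ f z w ∂area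

/-- The measure `(1 - |z|²)^(-κ/(1+κ)) dA(z)` on the disk. -/
def weightedArea (κ : ℝ) : Measure ℂ :=
  (area.restrict disk).withDensity
    (fun z => ENNReal.ofReal ((1 - ‖z‖ ^ 2) ^ (-(κ / (1 + κ)))))

/-- The space `L^((2+κ)/(1+κ))(𝔻, (1 - |z|²)^(-κ/(1+κ)) dA)` of complex-valued functions. -/
abbrev LSpace (κ : ℝ) : Type :=
  Lp ℂ (ENNReal.ofReal ((2 + κ) / (1 + κ))) (weightedArea κ)

/-- The closed unit ball of `LSpace κ`. -/
def unitBall (κ : ℝ) : Set (LSpace κ) := {f | ‖f‖ ≤ 1}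

/-- The integrand `δ(w)^κ / (|z-w|^(2+κ) + δ(w)^(2+κ))` of the Marcinkiewicz–Zygmund integral,
where `δ` is the distance to the boundary of `Ω`. -/
def mzIntegrand (κ : ℝ) (Ω : Set ℂ) (z w : ℂ) : ℝ :=
  infDist w (frontier Ω) ^ κ / (‖z - w‖ ^ (2 + κ) + infDist w (frontier Ω) ^ (2 + κ))

/-- The Marcinkiewicz–Zygmund integral of `Ω`. -/
def mzIntegral (κ : ℝ) (Ω : Set ℂ) (z : ℂ) : ℝ :=
  ∫ w in Ω, mzIntegrand κ Ω z w ∂area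

/-- `γ₀` is an exponential integrability constant for Marcinkiewicz–Zygmund integrals: for all
`κ ∈ (0,1)`, all bounded domains `Ω` and all real `c < γ₀ κ`, the integral `I_κ(z)` converges at
each `z ∈ Ω` and `∫_Ω exp(c I_κ(z)) dA(z) < ∞`. -/
def IsMZExpConstant (γ₀ : ℝ) : Prop :=
  ∀ κ : ℝ, 0 < κ → κ < 1 →
    ∀ Ω : Set ℂ, IsOpen Ω → IsConnected Ω → Bornology.IsBounded Ω →
      (∀ z ∈ Ω, IntegrableOn (mzIntegrand κ Ω z) Ω area) ∧
      ∀ c : ℝ, c < γ₀ * κ →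
        IntegrableOn (fun z => Real.exp (c * mzIntegral κ Ω z)) Ω area

end MZSobolev

end

/-! Let `K(z,w)` be the kernel of the transform and `Ω = φ(𝔻)`. Hölder with exponents `2+κ` and
`(2+κ)/(1+κ)`, the weight being split between the factors, bounds the supremum over the unit ball by
`∫ |K(z,w)|^(2+κ) (1-|w|²)^κ dA(w)`. With `d = δ(φ(w))`, a weak Koebe theorem gives `|φ'(w)|(1-|w|²)
≤ 64d`, while `|K|/|φ'(w)|` is at most both `1/|φ(w)-φ(z)|` (trivially) and `1/d` (Schwarz for the
inverse map). Hence the integrand is at most `128 |φ'(w)|²` times the Marcinkiewicz–Zygmund kernel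
at `(φ(z), φ(w))` (`norm_cauchyKernel_rpow_mul_le`). Changing variables, the supremum is at most
`128 I_κ(φ(z))`, and the outer factor `|φ'(z)|²` is again a Jacobian, so everything reduces to
exponential integrability of `I_κ` on `Ω`.

That is a duality argument. Integrating the kernel in its first variable against `g` costs at most
`(16/κ) Mg(w)`, with `M` the maximal operator (`lintegral_mzIntegrand_mul_le`). Take `g = e^h`,
where `h = c min(I_κ, N)`; the `L log L` bound `lintegral_maximalFn_exp_le` controls `∫ M(e^h)` by
the area plus `∫ h e^h`. Thus `X = ∫ min(I_κ, N) e^h` is bounded by a constant plus a multiple of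
`(c/κ) X`, which is absorbed when `c ≤ κ/6400`. The bound is uniform in `N`, and Fatou finishes
(`lintegral_exp_mzIntegral_lt_top`). -/

open Filter Topology
open scoped ENNReal

noncomputable section

namespace MZSobolev

/-! ### Holomorphic inverses of univalent maps. -/

section Univalent

variable {f : ℂ → ℂ} {U : Set ℂ}

theorem nhds_le_map_of_injOn (hU : IsOpen U) (hf : DifferentiableOn ℂ f U) (hinj : InjOn f U)
    {x : ℂ} (hx : x ∈ U) : 𝓝 (f x) ≤ map f (𝓝 x) := by
  refine (hf.analyticAt (hU.mem_nhds hx)).eventually_constant_or_nhds_le_map_nhds.resolve_left ?_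
  intro h
  have h' : ∀ᶠ z in 𝓝 x, z = x := by
    filter_upwards [h, hU.mem_nhds hx] with z hz hzU using hinj hzU hx hz
  have : ∀ᶠ z in 𝓝[≠] x, False := by
    filter_upwards [h'.filter_mono nhdsWithin_le_nhds, self_mem_nhdsWithin] with z h1 h2 using h2 h1
  exact (this.exists).elim fun _ h => h

theorem isOpen_image_of_injOn (hU : IsOpen U) (hf : DifferentiableOn ℂ f U) (hinj : InjOn f U) :
    IsOpen (f '' U) := by
  rw [isOpen_iff_mem_nhds]
  rintro _ ⟨x, hx, rfl⟩
  exact nhds_le_map_of_injOn hU hf hinj hx (image_mem_map (hU.mem_nhds hx))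

/-- Openness makes the inverse continuous, and it is differentiable at images of points with `f' ≠
0`. Zeros of `f'` are isolated, since otherwise `f` would be locally constant, so the remaining
points are removable singularities. Nonvanishing of `f'` is never needed. -/
theorem exists_differentiableOn_leftInverse (hU : IsOpen U) (hf : DifferentiableOn ℂ f U)
    (hinj : InjOn f U) :
    ∃ g : ℂ → ℂ, DifferentiableOn ℂ g (f '' U) ∧ ∀ x ∈ U, g (f x) = x := by
  have hleft : ∀ x ∈ U, Function.invFunOn f U (f x) = x := fun x hx =>
    hinj.leftInvOn_invFunOn hx
  set g := Function.invFunOn f U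
  have hcont : ∀ x ∈ U, ContinuousAt g (f x) := by
    intro x hx
    have h1 : Tendsto g (map f (𝓝 x)) (𝓝 x) := by
      rw [tendsto_map'_iff]
      refine tendsto_id.congr' ?_
      filter_upwards [hU.mem_nhds hx] with z hz using (hleft z hz).symm
    have h2 : Tendsto g (𝓝 (f x)) (𝓝 (g (f x))) := by
      rw [hleft x hx]
      exact h1.mono_left (nhds_le_map_of_injOn hU hf hinj hx)
    exact h2
  have hdiff : ∀ x ∈ U, deriv f x ≠ 0 → DifferentiableAt ℂ g (f x) := by
    intro x hx h0
    have hd : HasDerivAt f (deriv f x) (g (f x)) := by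
      rw [hleft x hx]
      exact (hf.differentiableAt (hU.mem_nhds hx)).hasDerivAt
    refine (hd.of_local_left_inverse (hcont x hx) h0 ?_).differentiableAt
    filter_upwards [(isOpen_image_of_injOn hU hf hinj).mem_nhds (mem_image_of_mem f hx)]
      with y hy
    exact Function.invFunOn_eq hy
  refine ⟨g, ?_, hleft⟩
  rintro _ ⟨x, hx, rfl⟩
  refine DifferentiableAt.differentiableWithinAt ?_
  refine (Complex.analyticAt_of_differentiable_on_punctured_nhds_of_continuousAt ?_
    (hcont x hx)).differentiableAt
  have hd : AnalyticAt ℂ (deriv f) x := (hf.analyticAt (hU.mem_nhds hx)).deriv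
  have hne : ∀ᶠ z in 𝓝[≠] x, deriv f z ≠ 0 := by
    refine hd.eventually_eq_zero_or_eventually_ne_zero.resolve_left ?_
    intro h0
    obtain ⟨r, hr, hball⟩ := Metric.eventually_nhds_iff_ball.1 (h0.and (hU.eventually_mem hx))
    have hconst : ∀ y ∈ ball x r, f y = f x := by
      intro y hy
      refine (convex_ball x r).is_const_of_fderivWithin_eq_zero (𝕜 := ℂ)
        (hf.mono fun z hz => (hball z hz).2) ?_ hy (mem_ball_self hr)
      intro z hz
      rw [fderivWithin_of_isOpen isOpen_ball hz]
      ext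
      simpa using (hball z hz).1
    have : ∀ᶠ z in 𝓝[≠] x, False := by
      filter_upwards [self_mem_nhdsWithin, nhdsWithin_le_nhds (ball_mem_nhds x hr)] with z h1 h2
      exact h1 (hinj (hball z h2).2 hx (hconst z h2))
    exact (this.exists).elim fun _ h => h
  -- Openness again: every point near `f x` is the image of a point near `x`, so punctured
  -- neighbourhoods transfer to the image side.
  have hle : 𝓝[≠] (f x) ≤ map f (𝓝[≠] x) := by
    intro s hs
    rw [mem_map, mem_nhdsWithin_iff_eventually] at hs
    have h1 : ∀ᶠ y in 𝓝 (f x), ∃ z, z ∈ U ∧ (z ≠ x → f z ∈ s) ∧ f z = y := by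
      have := nhds_le_map_of_injOn hU hf hinj hx
        (image_mem_map (inter_mem (hU.mem_nhds hx) hs))
      filter_upwards [this]
      rintro _ ⟨z, ⟨hz1, hz2⟩, rfl⟩
      exact ⟨z, hz1, hz2, rfl⟩
    rw [mem_nhdsWithin_iff_eventually]
    filter_upwards [h1]
    rintro y ⟨z, -, hz, rfl⟩ hne
    exact hz fun h => hne (by rw [h]; rfl)
  refine hle ?_
  rw [mem_map]
  filter_upwards [hne, nhdsWithin_le_nhds (hU.mem_nhds hx)] with z hz hzU using hdiff z hzU hz

end Univalent

/-! ### Koebe-type distortion. -/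

/-- Every zero-free holomorphic function on a disk has a holomorphic square root, with a prescribed
value at the centre. -/
theorem exists_holomorphic_sqrt {N : ℂ → ℂ} {c : ℂ} {r : ℝ} (hr : 0 < r)
    (hN : DifferentiableOn ℂ N (ball c r)) (h0 : ∀ u ∈ ball c r, N u ≠ 0) (h1 : N c = 1) :
    ∃ h : ℂ → ℂ, DifferentiableOn ℂ h (ball c r) ∧ h c = 1 ∧ ∀ u ∈ ball c r, h u ^ 2 = N u := by
  have hq : DifferentiableOn ℂ (fun u => deriv N u / N u) (ball c r) :=
    (hN.deriv isOpen_ball).div hN h0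
  obtain ⟨ℓ, hℓc, hℓ⟩ := hq.isExactOn_ball.with_val_at c 0
  have hder : ∀ u ∈ ball c r,
      HasDerivAt (fun u => N u * Complex.exp (-ℓ u)) 0 u := by
    intro u hu
    have hNu := (hN.differentiableAt (isOpen_ball.mem_nhds hu)).hasDerivAt
    refine (hNu.mul (hℓ u hu).neg.cexp).congr_deriv ?_
    have h2 := h0 u hu
    field_simp
    ring
  have hconst : ∀ u ∈ ball c r, N u * Complex.exp (-ℓ u) = 1 := by
    intro u hu
    have := (convex_ball c r).is_const_of_fderivWithin_eq_zero (𝕜 := ℂ)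
      (f := fun u => N u * Complex.exp (-ℓ u))
      (fun z hz => (hder z hz).differentiableAt.differentiableWithinAt) ?_ hu (mem_ball_self hr)
    · rw [this, hℓc, h1]; simp
    · intro z hz
      rw [fderivWithin_of_isOpen isOpen_ball hz]
      ext
      simpa using (hder z hz).deriv
  refine ⟨fun u => Complex.exp (ℓ u / 2), ?_, by simp [hℓc], ?_⟩
  · intro u hu
    exact ((hℓ u hu).div_const 2).cexp.differentiableAt.differentiableWithinAt
  · intro u hu
    rw [← Complex.exp_nat_mul]
    have h2 := hconst u hu
    rw [Complex.exp_neg] at h2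
    have h3 := Complex.exp_ne_zero (ℓ u)
    have h4 : N u = Complex.exp (ℓ u) := by field_simp at h2; exact h2
    rw [h4]; congr 1; push_cast; ring

/-- A distortion estimate of Koebe type: if an injective holomorphic function on a disk covers the
disk of radius `d` about its central value and omits a point at distance `d`, its derivative
there is controlled by `d`. -/
theorem norm_deriv_le_of_omits {g : ℂ → ℂ} {c a : ℂ} {r : ℝ} (hr : 0 < r)
    (hg : DifferentiableOn ℂ g (ball c r)) (hinj : InjOn g (ball c r))
    (ha : a ∉ g '' ball c r) (hball : ball (g c) (dist a (g c)) ⊆ g '' ball c r) :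
    ‖deriv g c‖ * r ≤ 32 * dist a (g c) := by
  have hc : c ∈ ball c r := mem_ball_self hr
  have hac : a - g c ≠ 0 := sub_ne_zero.2 fun h => ha (h ▸ mem_image_of_mem g hc)
  have hgd : ∀ u ∈ ball c r, DifferentiableAt ℂ g u := fun u hu =>
    hg.differentiableAt (isOpen_ball.mem_nhds hu)
  obtain ⟨h, hh, hhc, hsq⟩ := exists_holomorphic_sqrt (N := fun u => (a - g u) / (a - g c)) hr
    ((hg.const_sub a).div_const _)
    (fun u hu => div_ne_zero (sub_ne_zero.2 fun e => ha (e ▸ mem_image_of_mem g hu)) hac)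
    (div_self hac)
  obtain ⟨G, hG, hGinv⟩ := exists_differentiableOn_leftInverse isOpen_ball hg hinj
  set d := dist a (g c) with hd
  have hd0 : 0 < d := dist_pos.2 (sub_ne_zero.1 hac)
  have hmaps : ∀ y ∈ ball (g c) d, G y ∈ ball c r ∧ g (G y) = y := by
    intro y hy
    obtain ⟨u, hu, rfl⟩ := hball hy
    rw [hGinv u hu]; exact ⟨hu, rfl⟩
  have hsqG : ∀ y ∈ ball (g c) d, ‖h (G y) ^ 2 - 1‖ < 1 := by
    intro y hy
    rw [hsq _ (hmaps y hy).1, (hmaps y hy).2, div_sub_one hac, norm_div, ← dist_eq_norm a, ← hd,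
      div_lt_one hd0]
    have : a - y - (a - g c) = g c - y := by ring
    rw [this, ← dist_eq_norm, dist_comm]; exact hy
  -- A purely imaginary number has square `≤ 0`, at distance at least 1 from 1. So the real part
  -- keeps one sign on the connected ball, the sign it has at the centre.
  have hre : ∀ y ∈ ball (g c) d, (h (G y)).re ≠ 0 := by
    intro y hy h0
    have h1 := hsqG y hy
    have h2 := (Complex.abs_re_le_norm _).trans_lt h1
    have h3 : (h (G y) ^ 2 - 1).re = -(h (G y)).im ^ 2 - 1 := by
      simp [pow_two, h0]
    rw [h3, abs_lt] at h2
    nlinarith [sq_nonneg (h (G y)).im]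
  have hcontG : ContinuousOn (fun y => (h (G y)).re) (ball (g c) d) := by
    refine Complex.continuous_re.comp_continuousOn ?_
    exact hh.continuousOn.comp (hG.continuousOn.mono hball) fun y hy => (hmaps y hy).1
  have hpos : ∀ y ∈ ball (g c) d, 0 < (h (G y)).re := by
    intro y hy
    by_contra hneg
    have hcm : g c ∈ ball (g c) d := mem_ball_self hd0
    have := (convex_ball (g c) d).isPreconnected.intermediate_value hy hcm hcontG
    have h0 : (0 : ℝ) ∈ Icc (h (G y)).re (h (G (g c))).re := by
      rw [hGinv c hc, hhc]; simp; exact not_lt.1 hneg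
    obtain ⟨y', hy', hy0⟩ := this h0
    exact hre y' hy' hy0
  -- Near `-1` one has `|h²-1| ≤ (2/5)(12/5) < 1`, which puts `g u` in the covered ball, where by
  -- injectivity `Re h > 0`: a contradiction. So `h` stays away from `-1`.
  have hfar : ∀ u ∈ ball c r, 2 / 5 ≤ ‖h u + 1‖ := by
    intro u hu
    by_contra! hlt
    have h1 : ‖h u - 1‖ ≤ 2 + 2 / 5 := by
      have : h u - 1 = (h u + 1) - 2 := by ring
      rw [this]
      refine (norm_sub_le _ _).trans ?_
      simp; linarith
    have h2 : ‖h u ^ 2 - 1‖ < 1 := by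
      have : h u ^ 2 - 1 = (h u + 1) * (h u - 1) := by ring
      rw [this, norm_mul]
      nlinarith [norm_nonneg (h u + 1), norm_nonneg (h u - 1)]
    have h3 : g u ∈ ball (g c) d := by
      rw [hsq u hu, div_sub_one hac, norm_div, ← dist_eq_norm a, ← hd, div_lt_one hd0] at h2
      have e : a - g u - (a - g c) = g c - g u := by ring
      rw [e, ← dist_eq_norm, dist_comm] at h2; exact h2
    have h4 := hpos _ h3
    rw [hGinv u hu] at h4
    have h5 := (Complex.abs_re_le_norm _).trans_lt hlt
    simp [abs_lt] at h5
    linarith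
  have hne : ∀ u ∈ ball c r, h u + 1 ≠ 0 := fun u hu e => by
    have := hfar u hu; rw [e] at this; norm_num at this
  have hF : DifferentiableOn ℂ (fun u => (h u + 1)⁻¹) (ball c r) := (hh.add_const 1).inv hne
  have hFm : MapsTo (fun u => (h u + 1)⁻¹) (ball c r) (closedBall ((h c + 1)⁻¹) 4) := by
    intro u hu
    rw [mem_closedBall, dist_eq_norm]
    refine (norm_sub_le _ _).trans ?_
    have e1 : ‖(h u + 1)⁻¹‖ ≤ (2 / 5 : ℝ)⁻¹ := by
      rw [norm_inv]; exact inv_anti₀ (by norm_num) (hfar u hu)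
    have e2 : ‖(h c + 1)⁻¹‖ ≤ (2 / 5 : ℝ)⁻¹ / 2 := by
      rw [hhc, norm_inv]; norm_num
    norm_num at e1 e2 ⊢; linarith
  -- As `h c = 1`, this reads `|h'(c)|/4 ≤ 4/r`. With `g'(c) = -2 h'(c)(a - g c)` it yields the
  -- constant 32.
  have hS := Complex.norm_deriv_le_div_of_mapsTo_ball hF hFm hr
  have hhd : HasDerivAt h (deriv h c) c := (hh.differentiableAt (isOpen_ball.mem_nhds hc)).hasDerivAt
  have hFd := ((hhd.add_const 1).inv (hne c hc)).deriv
  have hFd' : deriv (fun u => (h u + 1)⁻¹) c = -deriv h c / (h c + 1) ^ 2 := hFd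
  rw [hFd', hhc, norm_div, norm_neg] at hS
  norm_num at hS
  have hder : 2 * deriv h c = -deriv g c / (a - g c) := by
    have e1 := (hhd.pow 2)
    have e2 := (((hgd c hc).hasDerivAt.const_sub a).div_const (a - g c))
    have e3 : (fun u => (a - g u) / (a - g c)) =ᶠ[𝓝 c] h ^ 2 := by
      filter_upwards [isOpen_ball.mem_nhds hc] with u hu using (hsq u hu).symm
    have := (e2.congr_of_eventuallyEq e3.symm).unique e1
    rw [this, hhc]; simp
  have hder' : deriv g c = -(2 * deriv h c * (a - g c)) := by
    rw [hder]; field_simp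
  rw [hder', norm_neg, norm_mul, norm_mul, ← dist_eq_norm, ← hd]
  rw [div_le_div_iff₀ (by norm_num) hr] at hS
  norm_num
  nlinarith

/-- A weak form of the Koebe one-quarter theorem. -/
theorem ball_subset_image_of_injOn {g : ℂ → ℂ} {c : ℂ} {r : ℝ} (hr : 0 < r)
    (hg : DifferentiableOn ℂ g (ball c r)) (hinj : InjOn g (ball c r))
    (hne : g '' ball c r ≠ univ) :
    ball (g c) (‖deriv g c‖ * r / 32) ⊆ g '' ball c r := by
  have hc : g c ∈ g '' ball c r := mem_image_of_mem g (mem_ball_self hr)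
  obtain ⟨a, ha, had⟩ := exists_mem_frontier_infDist_compl_eq_dist hc hne
  have ha' : a ∉ g '' ball c r := by
    rw [(isOpen_image_of_injOn isOpen_ball hg hinj).frontier_eq] at ha
    exact ha.2
  rw [dist_comm] at had
  have hball := ball_infDist_compl_subset (x := g c) (s := g '' ball c r)
  rw [had] at hball
  have := norm_deriv_le_of_omits hr hg hinj ha' hball
  exact (ball_subset_ball (by linarith)).trans hball

/-! ### Normalized area. -/

section Area

instance : SigmaFinite area := by
  have : area = (Real.toNNReal Real.pi⁻¹) • (volume : Measure ℂ) := rfl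
  rw [this]; infer_instance

theorem area_ball (x : ℂ) {r : ℝ} (hr : 0 ≤ r) : area (ball x r) = ENNReal.ofReal (r ^ 2) := by
  rw [area, Measure.smul_apply, Complex.volume_ball, smul_eq_mul, mul_left_comm,
    ← ENNReal.ofReal_pow hr, ← ENNReal.ofReal_coe_nnreal, ← ENNReal.ofReal_mul (by positivity)]
  simp [Real.pi_ne_zero]

theorem area_closedBall (x : ℂ) {r : ℝ} (hr : 0 ≤ r) :
    area (closedBall x r) = ENNReal.ofReal (r ^ 2) := by
  rw [area, Measure.smul_apply, Complex.volume_closedBall, smul_eq_mul, mul_left_comm,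
    ← ENNReal.ofReal_pow hr, ← ENNReal.ofReal_coe_nnreal, ← ENNReal.ofReal_mul (by positivity)]
  simp [Real.pi_ne_zero]

theorem area_lt_top_of_isBounded {s : Set ℂ} (hs : Bornology.IsBounded s) : area s < ∞ := by
  obtain ⟨R, hR, hsub⟩ := hs.subset_ball_lt 0 0
  exact (measure_mono hsub).trans_lt (by rw [area_ball 0 hR.le]; exact ENNReal.ofReal_lt_top)

end Area

/-! ### The maximal function and its `L log L` bound. -/

/-- The centred Hardy–Littlewood maximal function of a nonnegative function on the plane. -/
def maximalFn (g : ℂ → ℝ≥0∞) (w : ℂ) : ℝ≥0∞ :=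
  ⨆ (r : ℝ) (_ : 0 < r), (∫⁻ z in ball w r, g z ∂area) / ENNReal.ofReal (r ^ 2)

theorem lintegral_ball_le_maximalFn (g : ℂ → ℝ≥0∞) (w : ℂ) {r : ℝ} (hr : 0 < r) :
    ∫⁻ z in ball w r, g z ∂area ≤ ENNReal.ofReal (r ^ 2) * maximalFn g w := by
  have h : (∫⁻ z in ball w r, g z ∂area) / ENNReal.ofReal (r ^ 2) ≤ maximalFn g w :=
    le_iSup₂ (f := fun (r : ℝ) (_ : 0 < r) =>
      (∫⁻ z in ball w r, g z ∂area) / ENNReal.ofReal (r ^ 2)) r hr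
  rwa [ENNReal.div_le_iff' (by simp; positivity) ENNReal.ofReal_ne_top] at h

theorem lt_maximalFn_iff {g : ℂ → ℝ≥0∞} {w : ℂ} {t : ℝ≥0∞} :
    t < maximalFn g w ↔
      ∃ r : ℝ, 0 < r ∧ t * ENNReal.ofReal (r ^ 2) < ∫⁻ z in ball w r, g z ∂area := by
  simp only [maximalFn, lt_iSup_iff, exists_prop]
  refine exists_congr fun r => and_congr_right fun hr => ?_
  rw [ENNReal.lt_div_iff_mul_lt (Or.inl (by simp; positivity)) (Or.inl ENNReal.ofReal_ne_top)]

/-- The strict inequality survives a slight shrinking of the ball, and the shrunken ball lies in the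
full-radius ball about any nearby centre. -/
theorem isOpen_lt_maximalFn (g : ℂ → ℝ≥0∞) (t : ℝ≥0∞) : IsOpen {w | t < maximalFn g w} := by
  rw [Metric.isOpen_iff]
  intro w hw
  obtain ⟨r, hr, hlt⟩ := lt_maximalFn_iff.1 hw
  have hU : ball w r = ⋃ n : ℕ, ball w (r - 1 / (n + 1)) := by
    ext z
    simp only [mem_ball, mem_iUnion]
    constructor
    · intro h
      obtain ⟨n, hn⟩ := exists_nat_one_div_lt (sub_pos.2 h)
      exact ⟨n, by linarith⟩
    · rintro ⟨n, hn⟩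
      have : (0 : ℝ) < 1 / (n + 1) := by positivity
      linarith
  have hdir : Directed (· ⊆ ·) fun n : ℕ => ball w (r - 1 / ((n : ℝ) + 1)) := by
    refine Monotone.directed_le (fun m n hmn => ball_subset_ball ?_)
    have : 1 / ((n : ℝ) + 1) ≤ 1 / ((m : ℝ) + 1) := Nat.one_div_le_one_div hmn
    linarith
  rw [hU, setLIntegral_iUnion_of_directed g hdir, lt_iSup_iff] at hlt
  obtain ⟨n, hn⟩ := hlt
  refine ⟨1 / ((n : ℝ) + 1), by positivity, fun w' hw' => lt_maximalFn_iff.2 ⟨r, hr, ?_⟩⟩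
  refine hn.trans_le (lintegral_mono_set (ball_subset_ball' ?_))
  rw [mem_ball, dist_comm] at hw'
  linarith

theorem measurable_maximalFn (g : ℂ → ℝ≥0∞) : Measurable (maximalFn g) :=
  measurable_of_Ioi fun t => (isOpen_lt_maximalFn g t).measurableSet

/-- The weak type (1,1) inequality for the maximal function. -/
theorem mul_area_lt_maximalFn_le (g : ℂ → ℝ≥0∞) {t : ℝ≥0∞} (ht0 : t ≠ 0) (ht : t ≠ ∞) :
    t * area {w | t < maximalFn g w} ≤ 16 * ∫⁻ z, g z ∂area := by
  by_cases hg : ∫⁻ z, g z ∂area = ∞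
  · rw [hg]; simp
  set E := {w | t < maximalFn g w}
  have hE : ∀ w : E, ∃ r : ℝ, 0 < r ∧
      t * ENNReal.ofReal (r ^ 2) < ∫⁻ z in ball (w : ℂ) r, g z ∂area :=
    fun w => lt_maximalFn_iff.1 w.2
  choose r hr0 hr using hE
  -- Vitali needs bounded radii, which the finite total mass of `g` supplies. The enlargement factor
  -- 4 becomes 16 in area.
  have hbound : ∀ a ∈ (univ : Set E), r a ≤ √((∫⁻ z, g z ∂area) / t).toReal := by
    intro a _
    refine Real.le_sqrt_of_sq_le ?_
    rw [← ENNReal.ofReal_le_iff_le_toReal (ENNReal.div_ne_top hg ht0),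
      ENNReal.le_div_iff_mul_le (Or.inl ht0) (Or.inl ht), mul_comm]
    exact (hr a).le.trans (setLIntegral_le_lintegral _ _)
  obtain ⟨u, -, hdisj, hcov⟩ := Vitali.exists_disjoint_subfamily_covering_enlargement_closedBall
    univ (fun a : E => (a : ℂ)) r _ hbound 4 (by norm_num)
  have hu : u.Countable := hdisj.countable_of_nonempty_interior fun a _ =>
    ⟨a, ball_subset_interior_closedBall (mem_ball_self (hr0 a))⟩
  have hsub : E ⊆ ⋃ b ∈ u, closedBall (b : ℂ) (4 * r b) := by
    intro w hw
    obtain ⟨b, hb, h⟩ := hcov ⟨w, hw⟩ (mem_univ _)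
    exact mem_biUnion hb (h (mem_closedBall_self (hr0 _).le))
  have := hu.to_subtype
  calc t * area E ≤ t * ∑' b : u, area (closedBall (b : ℂ) (4 * r b)) := by
        gcongr
        exact (measure_mono hsub).trans (measure_biUnion_le _ hu _)
    _ = ∑' b : u, 16 * (t * ENNReal.ofReal (r b ^ 2)) := by
        rw [← ENNReal.tsum_mul_left]
        congr 1; ext b
        rw [area_closedBall _ (by linarith [hr0 b]), mul_pow, ENNReal.ofReal_mul (by norm_num)]
        norm_num
        ring
    _ ≤ ∑' b : u, 16 * ∫⁻ z in closedBall (b : ℂ) (r b), g z ∂area := by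
        refine ENNReal.tsum_le_tsum fun b => ?_
        gcongr
        exact (hr b).le.trans (lintegral_mono_set ball_subset_closedBall)
    _ = 16 * ∫⁻ z in ⋃ b ∈ u, closedBall (b : ℂ) (r b), g z ∂area := by
        rw [ENNReal.tsum_mul_left, lintegral_biUnion hu (fun _ _ => measurableSet_closedBall) hdisj]
    _ ≤ 16 * ∫⁻ z, g z ∂area := by
        gcongr
        exact Measure.restrict_le_self

/-- Allows truncation: the part of a function below a level `a` raises the maximal function by at
most `a`. -/
theorem maximalFn_le_add_const {g g' : ℂ → ℝ≥0∞} {a : ℝ≥0∞} (h : ∀ z, g z ≤ g' z + a) (w : ℂ) :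
    maximalFn g w ≤ maximalFn g' w + a := by
  refine iSup₂_le fun r hr => ?_
  rw [ENNReal.div_le_iff' (by simp; positivity) ENNReal.ofReal_ne_top, mul_add]
  calc ∫⁻ z in ball w r, g z ∂area ≤ ∫⁻ z in ball w r, (g' z + a) ∂area := lintegral_mono h
    _ = (∫⁻ z in ball w r, g' z ∂area) + ENNReal.ofReal (r ^ 2) * a := by
        rw [lintegral_add_right _ measurable_const, setLIntegral_const, area_ball w hr.le, mul_comm]
    _ ≤ _ := by gcongr; exact lintegral_ball_le_maximalFn g' w hr

/-- A layer decomposition along exponential levels: if `e < x < ∞`, the single term with `e^(j+1) <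
x ≤ e^(j+2)` suffices; at `x = ∞` the series diverges. -/
theorem le_exp_add_tsum_indicator (x : ℝ≥0∞) :
    x ≤ ENNReal.ofReal (Real.exp 1) + ∑' j : ℕ, (Ioi (ENNReal.ofReal (Real.exp (j + 1)))).indicator
      (fun _ => ENNReal.ofReal (Real.exp (j + 2))) x := by
  rcases le_or_gt x (ENNReal.ofReal (Real.exp 1)) with h | h
  · exact h.trans le_self_add
  refine le_trans ?_ le_add_self
  induction x using ENNReal.recTopCoe with
  | top =>
    rw [← ENNReal.tsum_const_eq_top_of_ne_zero (α := ℕ) (one_ne_zero)]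
    refine ENNReal.tsum_le_tsum fun j => ?_
    rw [indicator_of_mem (by simp)]
    simp; positivity
  | coe t =>
    rw [← ENNReal.ofReal_coe_nnreal, ENNReal.ofReal_lt_ofReal_iff_of_nonneg (by positivity)] at h
    have ht : (0 : ℝ) < t := (Real.exp_pos 1).trans h
    have hlog : 1 < Real.log t := (Real.lt_log_iff_exp_lt ht).2 h
    set j := ⌈Real.log t⌉₊ - 2 with hj
    have h2 : 2 ≤ ⌈Real.log t⌉₊ := Nat.lt_ceil.2 (by exact_mod_cast hlog)
    have hc : ((⌈Real.log t⌉₊ : ℕ) : ℝ) = j + 2 := by rw [hj]; push_cast [h2]; ring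
    have h3 := Nat.le_ceil (Real.log t)
    have h4 := Nat.ceil_lt_add_one (by linarith : 0 ≤ Real.log t)
    rw [hc] at h3 h4
    refine le_trans ?_ (ENNReal.le_tsum j)
    rw [← ENNReal.ofReal_coe_nnreal, indicator_of_mem]
    · exact ENNReal.ofReal_le_ofReal ((Real.log_le_iff_le_exp ht).1 h3)
    · rw [mem_Ioi, ENNReal.ofReal_lt_ofReal_iff_of_nonneg (by positivity)]
      exact (Real.lt_log_iff_exp_lt ht).1 (by linarith)

theorem tsum_indicator_lt_le {x : ℝ} (hx : 0 ≤ x) :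
    ∑' j : ℕ, (Ioi (j : ℝ)).indicator (fun _ => (1 : ℝ≥0∞)) x ≤ ENNReal.ofReal (x + 1) := by
  rw [tsum_eq_sum (s := Finset.range ⌈x⌉₊)]
  · refine (Finset.sum_le_card_nsmul _ _ 1 fun j _ =>
      indicator_le_self' (f := fun _ => (1 : ℝ≥0∞)) (by simp) x).trans ?_
    rw [Finset.card_range, nsmul_eq_mul, mul_one, ← ENNReal.ofReal_natCast]
    exact ENNReal.ofReal_le_ofReal (Nat.ceil_lt_add_one hx).le
  · intro j hj
    rw [Finset.mem_range, not_lt] at hj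
    refine indicator_of_notMem ?_ _
    rw [mem_Ioi, not_lt]
    exact (Nat.le_ceil x).trans (by exact_mod_cast hj)

/-- An `L log L` bound for the maximal function, for a density written as an exponential. -/
theorem lintegral_maximalFn_exp_le {Ω : Set ℂ} (hΩ : MeasurableSet Ω) {h : ℂ → ℝ}
    (hm : Measurable h) (h0 : ∀ z, 0 ≤ h z) :
    ∫⁻ w in Ω, maximalFn (Ω.indicator fun z => ENNReal.ofReal (Real.exp (h z))) w ∂area ≤
      303 * area Ω + 200 * ∫⁻ z in Ω, ENNReal.ofReal (h z * Real.exp (h z)) ∂area := by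
  set g : ℂ → ℝ≥0∞ := Ω.indicator fun z => ENNReal.ofReal (Real.exp (h z)) with hg
  have hgm : Measurable g :=
    (by fun_prop : Measurable fun z => ENNReal.ofReal (Real.exp (h z))).indicator hΩ
  have he : Real.exp 1 < 3 := by linarith [Real.exp_one_lt_d9]
  have hlevel : ∀ j : ℕ, ENNReal.ofReal (Real.exp (j + 2)) *
      area {w | ENNReal.ofReal (Real.exp (j + 1)) < maximalFn g w} ≤
        100 * ∫⁻ z, (Ioi (j : ℝ)).indicator (fun _ => (1 : ℝ≥0∞)) (h z) * g z ∂area := by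
    intro j
    set g' : ℂ → ℝ≥0∞ := fun z => (Ioi (j : ℝ)).indicator (fun _ => (1 : ℝ≥0∞)) (h z) * g z
    -- Where `h ≤ j`, the density is at most `e^j ≤ e^(j+1)/2`; only the part with `h > j` can
    -- account for the other half of the level.
    have hsub : {w | ENNReal.ofReal (Real.exp (j + 1)) < maximalFn g w} ⊆
        {w | ENNReal.ofReal (Real.exp (j + 1) / 2) < maximalFn g' w} := by
      intro w hw
      by_contra hle
      replace hle : maximalFn g' w ≤ _ := not_lt.1 hle
      refine (show _ < _ from hw).not_ge ((maximalFn_le_add_const (g' := g')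
        (a := ENNReal.ofReal (Real.exp (j + 1) / 2))
        ?_ w).trans ?_)
      · intro z
        by_cases hz : (j : ℝ) < h z
        · simp [g', hz]
        · refine le_trans ?_ le_add_self
          refine (indicator_le_self' (by simp) z).trans (ENNReal.ofReal_le_ofReal ?_)
          rw [Real.exp_add]
          have h1 := Real.add_one_le_exp 1
          have h2 := Real.exp_le_exp.2 (not_lt.1 hz)
          nlinarith [Real.exp_pos (j : ℝ)]
      · refine (add_le_add_left hle _).trans ?_
        rw [← ENNReal.ofReal_add (by positivity) (by positivity), add_halves]
    have hw := mul_area_lt_maximalFn_le g' (t := ENNReal.ofReal (Real.exp (j + 1) / 2))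
      (by simp; positivity) ENNReal.ofReal_ne_top
    calc ENNReal.ofReal (Real.exp (j + 2)) *
          area {w | ENNReal.ofReal (Real.exp (j + 1)) < maximalFn g w}
        ≤ (ENNReal.ofReal 6 * ENNReal.ofReal (Real.exp (j + 1) / 2)) *
          area {w | ENNReal.ofReal (Real.exp (j + 1) / 2) < maximalFn g' w} := by
          refine mul_le_mul' ?_ (measure_mono hsub)
          rw [← ENNReal.ofReal_mul (by norm_num)]
          refine ENNReal.ofReal_le_ofReal ?_
          rw [show (j : ℝ) + 2 = 1 + (j + 1) by ring, Real.exp_add]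
          nlinarith [Real.exp_pos ((j : ℝ) + 1)]
      _ ≤ ENNReal.ofReal 6 * (16 * ∫⁻ z, g' z ∂area) := by
          rw [mul_assoc]; gcongr
      _ ≤ 100 * ∫⁻ z, g' z ∂area := by
          rw [← mul_assoc]
          gcongr
          norm_num
  -- At most `h + 1` levels `j` lie below `h`, and `(h+1)e^h ≤ 3 + 2he^h`. The level factor 100 then
  -- gives `303 = 3 + 100·3` and `200 = 100·2`.
  have hpt : ∀ z, (∑' j : ℕ, (Ioi (j : ℝ)).indicator (fun _ => (1 : ℝ≥0∞)) (h z) * g z) ≤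
      Ω.indicator (fun z => 3 + 2 * ENNReal.ofReal (h z * Real.exp (h z))) z := by
    intro z
    rw [ENNReal.tsum_mul_right]
    by_cases hz : z ∈ Ω
    · rw [hg, indicator_of_mem hz, indicator_of_mem hz]
      refine (mul_le_mul_left (tsum_indicator_lt_le (h0 z)) _).trans ?_
      have hz0 := h0 z
      rw [← ENNReal.ofReal_mul (by positivity),
        show (3 : ℝ≥0∞) + 2 * ENNReal.ofReal (h z * Real.exp (h z)) =
          ENNReal.ofReal (3 + 2 * (h z * Real.exp (h z))) by
        rw [ENNReal.ofReal_add (by norm_num) (by positivity), ENNReal.ofReal_mul zero_le_two,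
          ENNReal.ofReal_ofNat, ENNReal.ofReal_ofNat]]
      refine ENNReal.ofReal_le_ofReal ?_
      rcases le_total (h z) 1 with h1 | h1
      · have := Real.exp_le_exp.2 h1
        nlinarith [Real.exp_pos (h z)]
      · nlinarith [Real.exp_pos (h z)]
    · simp [hg, hz]
  calc ∫⁻ w in Ω, maximalFn g w ∂area
      ≤ ∫⁻ w in Ω, (ENNReal.ofReal (Real.exp 1) + ∑' j : ℕ,
          {w | ENNReal.ofReal (Real.exp (j + 1)) < maximalFn g w}.indicator
            (fun _ => ENNReal.ofReal (Real.exp (j + 2))) w) ∂area :=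
        lintegral_mono fun w => le_exp_add_tsum_indicator (maximalFn g w)
    _ = ENNReal.ofReal (Real.exp 1) * area Ω + ∑' j : ℕ, ENNReal.ofReal (Real.exp (j + 2)) *
          area.restrict Ω {w | ENNReal.ofReal (Real.exp (j + 1)) < maximalFn g w} := by
        rw [lintegral_add_left measurable_const, setLIntegral_const, lintegral_tsum]
        · simp_rw [lintegral_indicator_const (isOpen_lt_maximalFn g _).measurableSet]
        · exact fun j => (measurable_const.indicator
            (isOpen_lt_maximalFn g _).measurableSet).aemeasurable
    _ ≤ 3 * area Ω + ∑' j : ℕ,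
          100 * ∫⁻ z, (Ioi (j : ℝ)).indicator (fun _ => (1 : ℝ≥0∞)) (h z) * g z ∂area := by
        refine add_le_add ?_ (ENNReal.tsum_le_tsum fun j => ?_)
        · gcongr
          exact (ENNReal.ofReal_le_ofReal he.le).trans (by norm_num)
        · exact (mul_le_mul_right (Measure.restrict_apply_le _ _) _).trans (hlevel j)
    _ = 3 * area Ω + 100 * ∫⁻ z, ∑' j : ℕ,
          (Ioi (j : ℝ)).indicator (fun _ => (1 : ℝ≥0∞)) (h z) * g z ∂area := by
        rw [ENNReal.tsum_mul_left, lintegral_tsum]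
        intro j
        exact (((measurable_const.indicator measurableSet_Ioi).comp hm).mul hgm).aemeasurable
    _ ≤ 3 * area Ω + 100 * ∫⁻ z in Ω, (3 + 2 * ENNReal.ofReal (h z * Real.exp (h z))) ∂area := by
        rw [← lintegral_indicator hΩ]
        gcongr with z
        exact hpt z
    _ = _ := by
        rw [lintegral_add_left measurable_const, setLIntegral_const,
          lintegral_const_mul _ (by fun_prop)]
        ring

/-! ### Marcinkiewicz–Zygmund integrals. -/

section Domain

variable {Ω : Set ℂ}

theorem frontier_nonempty_of_isBounded (hΩ : Bornology.IsBounded Ω) (hne : Ω.Nonempty) :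
    (frontier Ω).Nonempty :=
  nonempty_frontier_iff.2 ⟨hne, fun h => (NormedSpace.unbounded_univ ℝ ℂ) (h ▸ hΩ)⟩

theorem infDist_frontier_pos (ho : IsOpen Ω) (hΩ : Bornology.IsBounded Ω) {w : ℂ} (hw : w ∈ Ω) :
    0 < infDist w (frontier Ω) := by
  refine (isClosed_frontier.notMem_iff_infDist_pos
    (frontier_nonempty_of_isBounded hΩ ⟨w, hw⟩)).1 fun h => ?_
  rw [ho.frontier_eq] at h
  exact h.2 hw

theorem measurable_mzIntegrand (κ : ℝ) (Ω : Set ℂ) :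
    Measurable (Function.uncurry (mzIntegrand κ Ω)) := by
  have h1 : Measurable fun p : ℂ × ℂ => infDist p.2 (frontier Ω) :=
    ((continuous_infDist_pt _).comp continuous_snd).measurable
  have h2 : Measurable fun p : ℂ × ℂ => ‖p.1 - p.2‖ := by fun_prop
  exact (h1.pow_const κ).div ((h2.pow_const _).add (h1.pow_const _))

theorem mzIntegrand_nonneg (κ : ℝ) (Ω : Set ℂ) (z w : ℂ) : 0 ≤ mzIntegrand κ Ω z w :=
  have := infDist_nonneg (x := w) (s := frontier Ω)
  div_nonneg (by positivity) (by positivity)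

theorem mzIntegral_nonneg (κ : ℝ) (Ω : Set ℂ) (z : ℂ) : 0 ≤ mzIntegral κ Ω z :=
  integral_nonneg fun _ => mzIntegrand_nonneg κ Ω z _

theorem mzIntegrand_le_of_le_infDist {κ : ℝ} {z w : ℂ} {a : ℝ} (ha : 0 < a)
    (h : a ≤ infDist w (frontier Ω)) : mzIntegrand κ Ω z w ≤ (a ^ 2)⁻¹ := by
  set d := infDist w (frontier Ω) with hd
  have hd0 : 0 < d := ha.trans_le h
  rw [mzIntegrand, ← hd, div_le_iff₀ (by positivity), ← div_eq_inv_mul, le_div_iff₀ (by positivity),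
    show (2 : ℝ) + κ = κ + 2 by ring, Real.rpow_add hd0 κ 2, Real.rpow_two]
  have h1 : a ^ 2 ≤ d ^ 2 := by gcongr
  have h2 : 0 ≤ ‖z - w‖ ^ (κ + 2) := by positivity
  nlinarith [Real.rpow_pos_of_pos hd0 κ]

theorem mzIntegrand_le_of_le_norm {κ : ℝ} (hκ : 0 < κ) {z w : ℂ} {a D : ℝ} (ha : 0 < a)
    (h : a ≤ ‖z - w‖) (hD : infDist w (frontier Ω) ≤ D) :
    mzIntegrand κ Ω z w ≤ D ^ κ / a ^ (2 + κ) := by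
  have hd0 := infDist_nonneg (x := w) (s := frontier Ω)
  have h1 : 0 ≤ infDist w (frontier Ω) ^ (2 + κ) := by positivity
  refine div_le_div₀ (by have := hd0.trans hD; positivity)
    (Real.rpow_le_rpow hd0 hD hκ.le) (by positivity) ?_
  linarith [Real.rpow_le_rpow ha.le h (by linarith : 0 ≤ 2 + κ)]

/-- The kernel is bounded: within half the boundary distance of `z`, `δ(w)` is bounded below;
farther away `|z-w|` is, and `δ(w)` is bounded above. -/
theorem integrableOn_mzIntegrand {κ : ℝ} (hκ : 0 < κ) (ho : IsOpen Ω)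
    (hΩ : Bornology.IsBounded Ω) {z : ℂ} (hz : z ∈ Ω) :
    IntegrableOn (mzIntegrand κ Ω z) Ω area := by
  set d := infDist z (frontier Ω) with hd
  have hd0 : 0 < d := infDist_frontier_pos ho hΩ hz
  obtain ⟨a, ha⟩ := frontier_nonempty_of_isBounded hΩ ⟨z, hz⟩
  obtain ⟨D, hD⟩ := hΩ.subset_closedBall a
  refine Measure.integrableOn_of_bounded (M := max ((d / 2) ^ 2)⁻¹ (D ^ κ / (d / 2) ^ (2 + κ)))
    (area_lt_top_of_isBounded hΩ).ne
    ((measurable_mzIntegrand κ Ω).comp measurable_prodMk_left).aestronglyMeasurable ?_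
  refine (ae_restrict_iff' ho.measurableSet).2 (Eventually.of_forall fun w hw => ?_)
  rw [Real.norm_of_nonneg (mzIntegrand_nonneg _ _ _ _)]
  rcases lt_or_ge ‖z - w‖ (d / 2) with h | h
  · refine le_max_of_le_left (mzIntegrand_le_of_le_infDist (by positivity) ?_)
    have h1 := infDist_le_infDist_add_dist (s := frontier Ω) (x := z) (y := w)
    rw [dist_eq_norm, ← hd] at h1
    linarith
  · refine le_max_of_le_right (mzIntegrand_le_of_le_norm hκ (by positivity) h ?_)
    exact (infDist_le_dist_of_mem ha).trans (hD hw)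

theorem ofReal_mzIntegral {κ : ℝ} (hκ : 0 < κ) (ho : IsOpen Ω)
    (hΩ : Bornology.IsBounded Ω) {z : ℂ} (hz : z ∈ Ω) :
    ENNReal.ofReal (mzIntegral κ Ω z) = ∫⁻ w in Ω, ENNReal.ofReal (mzIntegrand κ Ω z w) ∂area :=
  ofReal_integral_eq_lintegral_ofReal (integrableOn_mzIntegrand hκ ho hΩ hz)
    (Eventually.of_forall fun _ => mzIntegrand_nonneg _ _ _ _)

theorem measurable_mzIntegral (κ : ℝ) (Ω : Set ℂ) : Measurable (mzIntegral κ Ω) :=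
  ((measurable_mzIntegrand κ Ω).stronglyMeasurable.integral_prod_right
    (ν := area.restrict Ω)).measurable

/-- Dyadic rings about `w` in units of `δ(w)`. A ring starting at `2^n δ(w)` lies in ball `n+1`;
this index shift costs `4·2^κ ≤ 8`. -/
theorem mzIntegrand_le_tsum {κ : ℝ} (hκ : 0 < κ) (hκ1 : κ < 1) {w : ℂ}
    (hd0 : 0 < infDist w (frontier Ω)) (z : ℂ) :
    ENNReal.ofReal (mzIntegrand κ Ω z w) ≤ ∑' j : ℕ,
      (ball w (2 ^ j * infDist w (frontier Ω))).indicator (fun _ => ENNReal.ofReal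
        (8 * (infDist w (frontier Ω) ^ 2)⁻¹ * ((4 ^ j)⁻¹ * ((1 / 2) ^ κ) ^ j))) z := by
  set d := infDist w (frontier Ω) with hd
  rcases lt_or_ge ‖z - w‖ d with h | h
  · refine le_trans ?_ (ENNReal.le_tsum 0)
    rw [indicator_of_mem (by simpa [dist_eq_norm] using h)]
    refine ENNReal.ofReal_le_ofReal ?_
    have h1 := mzIntegrand_le_of_le_infDist (κ := κ) (z := z) hd0 hd.le
    have h2 : 0 < (d ^ 2)⁻¹ := by positivity
    simp only [pow_zero, inv_one, mul_one]
    linarith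
  · obtain ⟨n, hn1, hn2⟩ := exists_nat_pow_near (x := ‖z - w‖ / d) (y := 2)
      ((one_le_div hd0).2 h) one_lt_two
    rw [le_div_iff₀ hd0] at hn1
    rw [div_lt_iff₀ hd0] at hn2
    refine le_trans ?_ (ENNReal.le_tsum (n + 1))
    rw [indicator_of_mem (by simpa [dist_eq_norm] using hn2)]
    refine ENNReal.ofReal_le_ofReal ?_
    refine (mzIntegrand_le_of_le_norm hκ (by positivity) hn1 hd.ge).trans ?_
    have hhalf : (1 / 2 : ℝ) ≤ (1 / 2) ^ κ := by
      simpa using Real.rpow_le_rpow_of_exponent_ge (by norm_num : (0:ℝ) < 1 / 2) (by norm_num) hκ1.le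
    have e1 : d ^ κ / (2 ^ n * d) ^ (2 + κ) = (d ^ 2)⁻¹ * ((4 ^ n)⁻¹ * ((1 / 2) ^ κ) ^ n) := by
      have hdk : 0 < d ^ κ := Real.rpow_pos_of_pos hd0 κ
      have h2k : (0 : ℝ) < 2 ^ κ := Real.rpow_pos_of_pos two_pos κ
      rw [Real.rpow_add (by positivity), Real.mul_rpow (x := 2 ^ n) (z := κ) (by positivity) hd0.le,
        Real.rpow_two, ← Real.rpow_natCast 2 n, ← Real.rpow_mul zero_le_two, mul_comm (n : ℝ) κ,
        Real.rpow_mul zero_le_two, Real.rpow_natCast, Real.rpow_natCast,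
        Real.div_rpow zero_le_one zero_le_two, Real.one_rpow,
        show (4 : ℝ) = 2 ^ 2 by norm_num, ← pow_mul, mul_comm 2 n, pow_mul]
      field_simp
      rw [← mul_pow, mul_one_div_cancel h2k.ne', one_pow]
    rw [e1, pow_succ (4 : ℝ), pow_succ ((1 / 2 : ℝ) ^ κ)]
    have h3 : 0 ≤ (d ^ 2)⁻¹ * ((4 ^ n)⁻¹ * ((1 / 2) ^ κ) ^ n) := by positivity
    have e2 : 8 * (d ^ 2)⁻¹ * (((4 : ℝ) ^ n * 4)⁻¹ * (((1 / 2) ^ κ) ^ n * (1 / 2) ^ κ)) =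
        ((d ^ 2)⁻¹ * ((4 ^ n)⁻¹ * ((1 / 2) ^ κ) ^ n)) * (2 * (1 / 2) ^ κ) := by
      rw [mul_inv]; ring
    rw [e2]
    exact le_mul_of_one_le_right h3 (by linarith)

/-- The Marcinkiewicz–Zygmund kernel, integrated in its first variable, is dominated by the maximal
function. -/
theorem lintegral_mzIntegrand_mul_le {κ : ℝ} (hκ : 0 < κ) (hκ1 : κ < 1) {w : ℂ}
    (hd0 : 0 < infDist w (frontier Ω)) {g : ℂ → ℝ≥0∞} (hg : Measurable g) :
    ∫⁻ z, ENNReal.ofReal (mzIntegrand κ Ω z w) * g z ∂area ≤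
      ENNReal.ofReal (16 / κ) * maximalFn g w := by
  have hker := mzIntegrand_le_tsum hκ hκ1 hd0
  set d := infDist w (frontier Ω) with hd
  set q : ℝ := (1 / 2) ^ κ with hq
  have hq0 : 0 < q := by positivity
  -- Bernoulli: the geometric ratio falls short of 1 by at least `κ/2`, which is the source of the
  -- factor `1/κ`.
  have hq1 : q ≤ 1 - κ / 2 := by
    have := rpow_one_add_le_one_add_mul_self (s := -1 / 2) (by norm_num) hκ.le hκ1.le
    rw [hq]; norm_num at this ⊢; linarith
  have hqlt : q < 1 := by linarith
  calc ∫⁻ z, ENNReal.ofReal (mzIntegrand κ Ω z w) * g z ∂area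
      ≤ ∫⁻ z, ∑' j : ℕ, ENNReal.ofReal (8 * (d ^ 2)⁻¹ * ((4 ^ j)⁻¹ * q ^ j)) *
          (ball w (2 ^ j * d)).indicator g z ∂area := by
        refine lintegral_mono fun z => (mul_le_mul_left (hker z) _).trans_eq ?_
        rw [← ENNReal.tsum_mul_right]
        refine tsum_congr fun j => ?_
        by_cases hz : z ∈ ball w (2 ^ j * d) <;> simp only [hz, indicator_of_mem,
          indicator_of_notMem, not_false_eq_true, zero_mul, mul_zero]
    _ = ∑' j : ℕ, ENNReal.ofReal (8 * (d ^ 2)⁻¹ * ((4 ^ j)⁻¹ * q ^ j)) *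
          ∫⁻ z in ball w (2 ^ j * d), g z ∂area := by
        rw [lintegral_tsum fun j => ((hg.indicator measurableSet_ball).const_mul _).aemeasurable]
        refine tsum_congr fun j => ?_
        rw [lintegral_const_mul _ (hg.indicator measurableSet_ball),
          lintegral_indicator measurableSet_ball]
    _ ≤ ∑' j : ℕ, ENNReal.ofReal (8 * q ^ j) * maximalFn g w := by
        refine ENNReal.tsum_le_tsum fun j => ?_
        refine (mul_le_mul_right (lintegral_ball_le_maximalFn g w (by positivity)) _).trans_eq ?_
        rw [← mul_assoc, ← ENNReal.ofReal_mul (by positivity)]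
        congr 2
        rw [mul_pow, ← pow_mul, mul_comm j 2, pow_mul, show (2 : ℝ) ^ 2 = 4 by norm_num]
        field_simp
    _ = ENNReal.ofReal (8 * (1 - q)⁻¹) * maximalFn g w := by
        rw [ENNReal.tsum_mul_right, ← ENNReal.ofReal_tsum_of_nonneg (fun j => by positivity)
          ((summable_geometric_of_lt_one hq0.le hqlt).mul_left 8), tsum_mul_left,
          tsum_geometric_of_lt_one hq0.le hqlt]
    _ ≤ _ := by
        gcongr
        rw [← div_eq_mul_inv, div_le_div_iff₀ (by linarith) hκ]
        linarith

/-- Exponential integrability of Marcinkiewicz–Zygmund integrals for small positive constants. -/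
theorem lintegral_exp_mzIntegral_lt_top {κ : ℝ} (hκ : 0 < κ) (hκ1 : κ < 1) (ho : IsOpen Ω)
    (hΩ : Bornology.IsBounded Ω) {c : ℝ} (hc : 0 ≤ c) (hcκ : c ≤ κ / 6400) :
    ∫⁻ z in Ω, ENNReal.ofReal (Real.exp (c * mzIntegral κ Ω z)) ∂area < ∞ := by
  set I := mzIntegral κ Ω with hI
  have hIm : Measurable I := measurable_mzIntegral κ Ω
  have hI0 : ∀ z, 0 ≤ I z := mzIntegral_nonneg κ Ω
  have hA := area_lt_top_of_isBounded hΩ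
  have hΩm := ho.measurableSet
  set C : ℝ≥0∞ := ENNReal.ofReal (32 / κ * 303) * area Ω with hC
  have hCtop : C < ∞ := ENNReal.mul_lt_top ENNReal.ofReal_lt_top hA
  have hX : ∀ N : ℕ, ∫⁻ z in Ω, ENNReal.ofReal
      (min (I z) N * Real.exp (c * min (I z) N)) ∂area ≤ C := by
    intro N
    set h : ℂ → ℝ := fun z => c * min (I z) N with hh
    have hm0 : ∀ z, 0 ≤ min (I z) N := fun z => le_min (hI0 z) (Nat.cast_nonneg N)
    have hhm : Measurable h := by fun_prop
    set g : ℂ → ℝ≥0∞ := Ω.indicator fun z => ENNReal.ofReal (Real.exp (h z)) with hg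
    have hgm : Measurable g :=
      (by fun_prop : Measurable fun z => ENNReal.ofReal (Real.exp (h z))).indicator hΩm
    set X := ∫⁻ z in Ω, ENNReal.ofReal (min (I z) N * Real.exp (c * min (I z) N)) ∂area with hXdef
    -- The truncation at `N` serves to make `X` finite, so that it may be absorbed.
    have hXtop : X < ∞ := by
      refine (setLIntegral_mono (g := fun _ => ENNReal.ofReal (N * Real.exp (c * N)))
        measurable_const fun z _ => ENNReal.ofReal_le_ofReal ?_).trans_lt
        (by rw [setLIntegral_const]; exact ENNReal.mul_lt_top ENNReal.ofReal_lt_top hA)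
      have := hm0 z
      gcongr <;> exact min_le_right _ _
    have hkey : X ≤ ENNReal.ofReal (16 / κ) * (303 * area Ω + 200 * (ENNReal.ofReal c * X)) := by
      calc X ≤ ∫⁻ z in Ω, (∫⁻ w in Ω, ENNReal.ofReal (mzIntegrand κ Ω z w) ∂area) * g z ∂area := by
            refine setLIntegral_mono' hΩm fun z hz => ?_
            rw [← ofReal_mzIntegral hκ ho hΩ hz, hg, indicator_of_mem hz,
              ← ENNReal.ofReal_mul (hI0 z)]
            refine ENNReal.ofReal_le_ofReal ?_
            gcongr
            exact min_le_left _ _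
        _ = ∫⁻ z in Ω, ∫⁻ w in Ω, ENNReal.ofReal (mzIntegrand κ Ω z w) * g z ∂area ∂area := by
            refine lintegral_congr fun z => ?_
            rw [lintegral_mul_const]
            exact ((measurable_mzIntegrand κ Ω).comp measurable_prodMk_left).ennreal_ofReal
        _ = ∫⁻ w in Ω, ∫⁻ z in Ω, ENNReal.ofReal (mzIntegrand κ Ω z w) * g z ∂area ∂area := by
            refine lintegral_lintegral_swap (Measurable.aemeasurable ?_)
            exact (measurable_mzIntegrand κ Ω).ennreal_ofReal.mul (hgm.comp measurable_fst)
        _ ≤ ∫⁻ w in Ω, ENNReal.ofReal (16 / κ) * maximalFn g w ∂area := by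
            refine setLIntegral_mono' hΩm fun w hw => ?_
            exact (setLIntegral_le_lintegral _ _).trans
              (lintegral_mzIntegrand_mul_le hκ hκ1 (infDist_frontier_pos ho hΩ hw) hgm)
        _ = ENNReal.ofReal (16 / κ) * ∫⁻ w in Ω, maximalFn g w ∂area :=
            lintegral_const_mul _ (measurable_maximalFn g)
        _ ≤ ENNReal.ofReal (16 / κ) *
              (303 * area Ω + 200 * ∫⁻ z in Ω, ENNReal.ofReal (h z * Real.exp (h z)) ∂area) := by
            gcongr
            exact lintegral_maximalFn_exp_le hΩm hhm fun z => mul_nonneg hc (hm0 z)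
        _ = _ := by
            rw [hXdef, ← lintegral_const_mul (ENNReal.ofReal c) (by fun_prop)]
            simp only [hh, mul_assoc, ENNReal.ofReal_mul hc]
    have hreal : X.toReal ≤ 16 / κ * (303 * (area Ω).toReal + 200 * (c * X.toReal)) := by
      have h1 : ENNReal.ofReal (16 / κ) * (303 * area Ω + 200 * (ENNReal.ofReal c * X)) ≠ ∞ := by
        finiteness
      have h2 := ENNReal.toReal_mono h1 hkey
      rw [ENNReal.toReal_mul, ENNReal.toReal_add (by finiteness) (by finiteness),
        ENNReal.toReal_mul, ENNReal.toReal_mul, ENNReal.toReal_mul,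
        ENNReal.toReal_ofReal (by positivity), ENNReal.toReal_ofReal hc] at h2
      simpa using h2
    rw [← ENNReal.ofReal_toReal hXtop.ne, hC, ← ENNReal.ofReal_toReal hA.ne,
      ← ENNReal.ofReal_mul (by positivity)]
    refine ENNReal.ofReal_le_ofReal ?_
    have hX0 : 0 ≤ X.toReal := ENNReal.toReal_nonneg
    -- Here `c ≤ κ/6400` enters: `3200 c/κ ≤ 1/2`.
    have h3 : 16 / κ * (200 * (c * X.toReal)) ≤ X.toReal / 2 := by
      have : 16 / κ * (200 * (c * X.toReal)) = (3200 * c / κ) * X.toReal := by ring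
      rw [this, div_eq_mul_inv (X.toReal), mul_comm (X.toReal)]
      gcongr
      rw [div_le_iff₀ hκ]; linarith
    have h4 : 32 / κ * 303 * (area Ω).toReal = 2 * (16 / κ * (303 * (area Ω).toReal)) := by ring
    rw [h4]
    rw [mul_add] at hreal
    linarith
  have hY : ∀ N : ℕ, ∫⁻ z in Ω, ENNReal.ofReal (Real.exp (c * min (I z) N)) ∂area ≤
      ENNReal.ofReal (Real.exp 1) * area Ω + ENNReal.ofReal c * C := by
    intro N
    calc ∫⁻ z in Ω, ENNReal.ofReal (Real.exp (c * min (I z) N)) ∂area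
        ≤ ∫⁻ z in Ω, (ENNReal.ofReal (Real.exp 1) + ENNReal.ofReal c * ENNReal.ofReal
            (min (I z) N * Real.exp (c * min (I z) N))) ∂area := by
          refine lintegral_mono fun z => ?_
          have hm0 : 0 ≤ min (I z) N := le_min (hI0 z) (Nat.cast_nonneg N)
          rw [← ENNReal.ofReal_mul hc, ← ENNReal.ofReal_add (by positivity) (by positivity),
            ← mul_assoc]
          refine ENNReal.ofReal_le_ofReal ?_
          rcases le_total (c * min (I z) N) 1 with h1 | h1
          · have := Real.exp_le_exp.2 h1
            have : 0 ≤ c * min (I z) N * Real.exp (c * min (I z) N) := by positivity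
            linarith
          · have := le_mul_of_one_le_left (Real.exp_pos (c * min (I z) N)).le h1
            linarith [Real.exp_pos 1]
      _ ≤ _ := by
          rw [lintegral_add_left measurable_const, setLIntegral_const,
            lintegral_const_mul _ (by fun_prop)]
          gcongr
          exact hX N
  refine lt_of_le_of_lt ?_ (show ENNReal.ofReal (Real.exp 1) * area Ω + ENNReal.ofReal c * C < ∞ by
    finiteness)
  have hlim : ∀ z, ENNReal.ofReal (Real.exp (c * I z)) ≤
      liminf (fun N : ℕ => ENNReal.ofReal (Real.exp (c * min (I z) N))) atTop := by
    intro z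
    refine (Tendsto.liminf_eq ?_).ge
    refine tendsto_const_nhds.congr' ?_
    filter_upwards [eventually_ge_atTop ⌈I z⌉₊] with N hN
    rw [min_eq_left (Nat.ceil_le.1 hN)]
  calc _ ≤ ∫⁻ z in Ω, liminf (fun N : ℕ => ENNReal.ofReal (Real.exp (c * min (I z) N))) atTop ∂area :=
        lintegral_mono hlim
    _ ≤ liminf (fun N : ℕ => ∫⁻ z in Ω, ENNReal.ofReal (Real.exp (c * min (I z) N)) ∂area) atTop :=
        lintegral_liminf_le fun N => by fun_prop
    _ ≤ _ := liminf_le_of_le (by isBoundedDefault) fun b hb => by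
        obtain ⟨N, hN⟩ := hb.exists
        exact hN.trans (hY N)

theorem isMZExpConstant_of_le {γ₀ : ℝ} (hγ : γ₀ ≤ 1 / 6400) : IsMZExpConstant γ₀ := by
  intro κ hκ hκ1 Ω ho _ hΩ
  refine ⟨fun z hz => integrableOn_mzIntegrand hκ ho hΩ hz, fun c hc => ?_⟩
  have hm : Measurable fun z => Real.exp (c * mzIntegral κ Ω z) :=
    ((measurable_mzIntegral κ Ω).const_mul c).exp
  refine ⟨hm.aestronglyMeasurable, ?_⟩
  rw [hasFiniteIntegral_iff_ofReal (Eventually.of_forall fun z => (Real.exp_pos _).le)]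
  -- A negative `c` is replaced by 0, as the integral is nonnegative.
  refine lt_of_le_of_lt (lintegral_mono fun z => ENNReal.ofReal_le_ofReal (Real.exp_le_exp.2
    (mul_le_mul_of_nonneg_right (le_max_left c 0) (mzIntegral_nonneg κ Ω z))))
    (lintegral_exp_mzIntegral_lt_top hκ hκ1 ho hΩ (le_max_right c 0) (max_le ?_ (by positivity)))
  nlinarith

end Domain

/-! ### Disk geometry and univalent images. -/

theorem isOpen_disk : IsOpen disk := isOpen_ball

theorem mem_disk {z : ℂ} : z ∈ disk ↔ ‖z‖ < 1 := mem_ball_zero_iff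

theorem one_sub_sq_pos {z : ℂ} (hz : z ∈ disk) : 0 < 1 - ‖z‖ ^ 2 := by
  have := mem_disk.1 hz
  nlinarith [norm_nonneg z]

theorem one_sub_conj_mul_ne_zero {z w : ℂ} (hz : z ∈ disk) (hw : w ∈ disk) :
    1 - starRingEnd ℂ w * z ≠ 0 := by
  intro h
  have h1 : ‖starRingEnd ℂ w * z‖ = 1 := by rw [← sub_eq_zero.1 h]; simp
  rw [norm_mul, RCLike.norm_conj] at h1
  have := mem_disk.1 hz
  have := mem_disk.1 hw
  nlinarith [norm_nonneg z, norm_nonneg w]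

/-- From `|1 - w̄z|² - |z-w|² = (1-|z|²)(1-|w|²)`. -/
theorem norm_sub_le_norm_one_sub_conj_mul {z w : ℂ} (hz : z ∈ disk) (hw : w ∈ disk) :
    ‖z - w‖ ≤ ‖1 - starRingEnd ℂ w * z‖ := by
  have h1 := one_sub_sq_pos hz
  have h2 := one_sub_sq_pos hw
  rw [← sq_le_sq₀ (norm_nonneg _) (norm_nonneg _)]
  simp only [← Complex.normSq_eq_norm_sq, Complex.normSq_apply] at *
  simp
  nlinarith [mul_pos h1 h2]

namespace IsBoundedUnivalent

variable {φ : ℂ → ℂ} (hφ : IsBoundedUnivalent φ)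
include hφ

theorem isOpen_image : IsOpen (φ '' disk) := isOpen_image_of_injOn isOpen_disk hφ.holo hφ.inj

theorem differentiableAt {w : ℂ} (hw : w ∈ disk) : DifferentiableAt ℂ φ w :=
  hφ.holo.differentiableAt (isOpen_disk.mem_nhds hw)

theorem image_ne_univ : φ '' disk ≠ univ := fun h =>
  NormedSpace.unbounded_univ ℝ ℂ (h ▸ hφ.bdd)

theorem infDist_pos {w : ℂ} (hw : w ∈ disk) : 0 < infDist (φ w) (frontier (φ '' disk)) :=
  infDist_frontier_pos hφ.isOpen_image hφ.bdd (mem_image_of_mem φ hw)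

theorem ball_infDist_subset {w : ℂ} (hw : w ∈ disk) :
    ball (φ w) (infDist (φ w) (frontier (φ '' disk))) ⊆ φ '' disk := by
  obtain ⟨y, hy, hd⟩ :=
    exists_mem_frontier_infDist_compl_eq_dist (mem_image_of_mem φ hw) hφ.image_ne_univ
  exact (ball_subset_ball (hd ▸ infDist_le_dist_of_mem hy)).trans ball_infDist_compl_subset

/-- Weak Koebe on the disk of radius `1-|w|` about `w`; the constant doubles because `1-|w|² ≤
2(1-|w|)`. -/
theorem norm_deriv_mul_le {w : ℂ} (hw : w ∈ disk) :
    ‖deriv φ w‖ * (1 - ‖w‖ ^ 2) ≤ 64 * infDist (φ w) (frontier (φ '' disk)) := by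
  have hw1 := mem_disk.1 hw
  have hsub : ball w (1 - ‖w‖) ⊆ disk := ball_subset_ball' (by simp)
  have hne : φ '' ball w (1 - ‖w‖) ≠ univ := fun h =>
    hφ.image_ne_univ (univ_subset_iff.1 (h ▸ image_mono hsub))
  have hK := (ball_subset_image_of_injOn (sub_pos.2 hw1) (hφ.holo.mono hsub)
    (hφ.inj.mono hsub) hne).trans (image_mono hsub)
  have hle : ‖deriv φ w‖ * (1 - ‖w‖) / 32 ≤ infDist (φ w) (frontier (φ '' disk)) := by
    refine (le_infDist (frontier_nonempty_of_isBounded hφ.bdd ⟨_, mem_image_of_mem φ hw⟩)).2 ?_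
    intro y hy
    by_contra! hlt
    rw [hφ.isOpen_image.frontier_eq] at hy
    exact hy.2 (hK (by rwa [mem_ball, dist_comm]))
  have h1 : 0 ≤ ‖deriv φ w‖ * (1 - ‖w‖) := mul_nonneg (norm_nonneg _) (sub_nonneg.2 hw1.le)
  nlinarith [norm_nonneg w]

/-- A lower distortion bound in terms of the pseudohyperbolic distance. -/
theorem norm_sub_mul_infDist_le {z w : ℂ} (hz : z ∈ disk) (hw : w ∈ disk) :
    ‖z - w‖ * infDist (φ w) (frontier (φ '' disk)) ≤
      ‖φ w - φ z‖ * ‖1 - starRingEnd ℂ w * z‖ := by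
  have hd0 := hφ.infDist_pos hw
  have hball := hφ.ball_infDist_subset hw
  set d := infDist (φ w) (frontier (φ '' disk))
  rcases le_or_gt d ‖φ w - φ z‖ with h | h
  · rw [mul_comm]
    exact mul_le_mul h (norm_sub_le_norm_one_sub_conj_mul hz hw) (norm_nonneg _) (norm_nonneg _)
  obtain ⟨G, hG, hinv⟩ := exists_differentiableOn_leftInverse isOpen_disk hφ.holo hφ.inj
  have hGd : ∀ v ∈ ball (φ w) d, G v ∈ disk := by
    intro v hv
    obtain ⟨u, hu, rfl⟩ := hball hv
    rwa [hinv u hu]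
  -- The inverse map followed by the disk automorphism sending `w` to 0, up to the unit bound a
  -- self-map of the kind Schwarz's lemma needs on the ball of radius `d`.
  have hF : DifferentiableOn ℂ (fun v => (G v - w) / (1 - starRingEnd ℂ w * G v))
      (ball (φ w) d) := by
    have hG' := hG.mono hball
    exact (hG'.sub_const w).div ((hG'.const_mul _).const_sub 1)
      fun v hv => one_sub_conj_mul_ne_zero (hGd v hv) hw
  have hFm : MapsTo (fun v => (G v - w) / (1 - starRingEnd ℂ w * G v)) (ball (φ w) d)
      (closedBall ((G (φ w) - w) / (1 - starRingEnd ℂ w * G (φ w))) 1) := by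
    intro v hv
    rw [hinv w hw, sub_self, zero_div, mem_closedBall_zero_iff, norm_div]
    exact div_le_one_of_le₀ (norm_sub_le_norm_one_sub_conj_mul (hGd v hv) hw) (norm_nonneg _)
  have hzb : φ z ∈ ball (φ w) d := by rwa [mem_ball, dist_comm, dist_eq_norm]
  have hS := Complex.dist_le_div_mul_dist_of_mapsTo_ball hF hFm hzb
  rw [hinv w hw, hinv z hz, sub_self, zero_div, dist_zero_right, norm_div, dist_comm, dist_eq_norm,
    div_mul_eq_mul_div, one_mul,
    div_le_div_iff₀ (norm_pos_iff.2 (one_sub_conj_mul_ne_zero hz hw)) hd0] at hS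
  exact hS

/-- The Jacobian change of variables under a univalent function. -/
theorem lintegral_image (F : ℂ → ℝ≥0∞) :
    ∫⁻ ζ in φ '' disk, F ζ ∂area =
      ∫⁻ w in disk, ENNReal.ofReal (‖deriv φ w‖ ^ 2) * F (φ w) ∂area := by
  have hderiv : ∀ x ∈ disk, HasFDerivWithinAt φ
      ((ContinuousLinearMap.toSpanSingleton ℂ (deriv φ x)).restrictScalars ℝ) disk x := fun x hx =>
    ((hφ.differentiableAt hx).hasDerivAt.hasFDerivAt.restrictScalars ℝ).hasFDerivWithinAt
  have hdet : ∀ a : ℂ, |((ContinuousLinearMap.toSpanSingleton ℂ a).restrictScalars ℝ).det| =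
      ‖a‖ ^ 2 := by
    intro a
    have : ((ContinuousLinearMap.toSpanSingleton ℂ a).restrictScalars ℝ).det = ‖a‖ ^ 2 := by
      simp [ContinuousLinearMap.det, LinearMap.det_restrictScalars,
        Algebra.norm_complex_eq, Complex.normSq_eq_norm_sq]
    rw [this, abs_of_nonneg (by positivity)]
  have h := lintegral_image_eq_lintegral_abs_det_fderiv_mul volume isOpen_disk.measurableSet
    hderiv hφ.inj F
  simp only [hdet] at h
  simp only [area, Measure.restrict_smul, lintegral_smul_measure, h]

end IsBoundedUnivalent

/-! ### Pointwise kernel bound. -/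

/-- The kernel of the transferred Cauchy transform. -/
def cauchyKernel (φ : ℂ → ℂ) (z w : ℂ) : ℂ :=
  deriv φ w / (φ w - φ z) * ((starRingEnd ℂ z - starRingEnd ℂ w) / (1 - starRingEnd ℂ w * z))

section Kernel

variable {φ : ℂ → ℂ} {κ : ℝ}

/-- Writing `|K| = |φ'|σ`, both `σΔ` and `σd` are at most 1, so `σ^(2+κ)` is at most 2 over the
denominator of the target kernel. The weight absorbs `|φ'|^κ` through Koebe with `64^κ ≤ 64`; hence
`128 = 2·64`. -/
theorem norm_cauchyKernel_rpow_mul_le (hφ : IsBoundedUnivalent φ) (hκ : 0 < κ) (hκ1 : κ < 1)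
    {z w : ℂ} (hz : z ∈ disk) (hw : w ∈ disk) :
    ‖cauchyKernel φ z w‖ ^ (2 + κ) * (1 - ‖w‖ ^ 2) ^ κ ≤
      128 * (‖deriv φ w‖ ^ 2 * mzIntegrand κ (φ '' disk) (φ z) (φ w)) := by
  have hd0 := hφ.infDist_pos hw
  have hdist := hφ.norm_sub_mul_infDist_le hz hw
  have hK := hφ.norm_deriv_mul_le hw
  have ht := one_sub_sq_pos hw
  rcases eq_or_ne (φ w) (φ z) with he | hne
  · have h0 : cauchyKernel φ z w = 0 := by simp [cauchyKernel, he]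
    rw [h0, norm_zero, Real.zero_rpow (by linarith), zero_mul]
    exact mul_nonneg (by norm_num) (mul_nonneg (by positivity) (mzIntegrand_nonneg _ _ _ _))
  have hΔ : 0 < ‖φ w - φ z‖ := norm_pos_iff.2 (sub_ne_zero.2 hne)
  have hm := norm_pos_iff.2 (one_sub_conj_mul_ne_zero hz hw)
  have hρ1 := norm_sub_le_norm_one_sub_conj_mul hz hw
  rw [mzIntegrand, ← norm_sub_rev (φ w) (φ z)]
  set d := infDist (φ w) (frontier (φ '' disk))
  set Δ := ‖φ w - φ z‖
  set m := ‖1 - starRingEnd ℂ w * z‖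
  set σ := ‖z - w‖ / (m * Δ) with hσ
  have hσ0 : 0 ≤ σ := by positivity
  have hker : ‖cauchyKernel φ z w‖ = ‖deriv φ w‖ * σ := by
    rw [cauchyKernel, norm_mul, norm_div, norm_div, ← map_sub, RCLike.norm_conj, hσ]
    change ‖deriv φ w‖ / Δ * (‖z - w‖ / m) = _
    field_simp
  have h1 : σ * Δ ≤ 1 := by
    rw [hσ, div_mul_eq_mul_div, div_le_one (by positivity)]; gcongr
  have h2 : σ * d ≤ 1 := by
    rw [hσ, div_mul_eq_mul_div, div_le_one (by positivity)]; linarith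
  have hsum : σ ^ (2 + κ) * (Δ ^ (2 + κ) + d ^ (2 + κ)) ≤ 2 := by
    rw [mul_add, ← Real.mul_rpow hσ0 hΔ.le, ← Real.mul_rpow hσ0 hd0.le]
    have e1 := Real.rpow_le_one (by positivity) h1 (by linarith : 0 ≤ 2 + κ)
    have e2 := Real.rpow_le_one (by positivity) h2 (by linarith : 0 ≤ 2 + κ)
    linarith
  have hpow : (‖deriv φ w‖ * (1 - ‖w‖ ^ 2)) ^ κ ≤ 64 * d ^ κ := by
    calc (‖deriv φ w‖ * (1 - ‖w‖ ^ 2)) ^ κ ≤ (64 * d) ^ κ :=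
          Real.rpow_le_rpow (by positivity) hK hκ.le
      _ = 64 ^ κ * d ^ κ := Real.mul_rpow (by norm_num) hd0.le
      _ ≤ 64 * d ^ κ := by
          gcongr
          simpa using Real.rpow_le_rpow_of_exponent_le (by norm_num : (1 : ℝ) ≤ 64) hκ1.le
  have hsplit : ‖cauchyKernel φ z w‖ ^ (2 + κ) * (1 - ‖w‖ ^ 2) ^ κ =
      ‖deriv φ w‖ ^ 2 * (‖deriv φ w‖ * (1 - ‖w‖ ^ 2)) ^ κ * σ ^ (2 + κ) := by
    rw [hker, Real.mul_rpow (norm_nonneg _) hσ0, Real.mul_rpow (norm_nonneg _) ht.le,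
      Real.rpow_add' (norm_nonneg _) (by linarith), Real.rpow_two]
    ring
  have hD : 0 < Δ ^ (2 + κ) + d ^ (2 + κ) := by positivity
  rw [hsplit]
  calc ‖deriv φ w‖ ^ 2 * (‖deriv φ w‖ * (1 - ‖w‖ ^ 2)) ^ κ * σ ^ (2 + κ)
      ≤ ‖deriv φ w‖ ^ 2 * (64 * d ^ κ) * (2 / (Δ ^ (2 + κ) + d ^ (2 + κ))) := by
        gcongr
        rwa [le_div_iff₀ hD]
    _ = _ := by ring

/-- Off the disk `φ` is arbitrary, so it is cut off to obtain joint measurability on the whole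
plane. -/
theorem measurable_uncurry_cauchyKernel_indicator (hφ : IsBoundedUnivalent φ) :
    Measurable fun p : ℂ × ℂ => deriv φ p.2 / (disk.indicator φ p.2 - disk.indicator φ p.1) *
      ((starRingEnd ℂ p.1 - starRingEnd ℂ p.2) / (1 - starRingEnd ℂ p.2 * p.1)) := by
  have h1 : Measurable (disk.indicator φ) := by
    classical
    rw [← piecewise_eq_indicator]
    exact hφ.holo.continuousOn.measurable_piecewise continuousOn_const isOpen_disk.measurableSet
  have h2 : Measurable (deriv φ) := measurable_deriv φ
  have h3 : Measurable (starRingEnd ℂ : ℂ → ℂ) := Complex.continuous_conj.measurable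
  fun_prop

end Kernel

/-! ### Hölder bound and exponential integrability of the transform. -/

section Transform

variable {φ : ℂ → ℂ} {κ : ℝ}

theorem cauchyIntegrand_eq (φ f : ℂ → ℂ) (z w : ℂ) :
    cauchyIntegrand φ f z w = cauchyKernel φ z w * f w := rfl

/-- The integrand of the transform agrees on the disk with a jointly measurable function. -/
theorem exists_measurable_cauchyIntegrand (hφ : IsBoundedUnivalent φ) {f : ℂ → ℂ}
    (hf : Measurable f) : ∃ H : ℂ × ℂ → ℂ, Measurable H ∧
      ∀ z ∈ disk, ∀ w ∈ disk, H (z, w) = cauchyIntegrand φ f z w := by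
  refine ⟨_, (measurable_uncurry_cauchyKernel_indicator hφ).mul (hf.comp measurable_snd), ?_⟩
  intro z hz w hw
  simp [cauchyIntegrand, indicator_of_mem hz, indicator_of_mem hw]

theorem aestronglyMeasurable_cauchyIntegrand (hφ : IsBoundedUnivalent φ) {f : ℂ → ℂ}
    (hf : Measurable f) {z : ℂ} (hz : z ∈ disk) :
    AEStronglyMeasurable (cauchyIntegrand φ f z) (area.restrict disk) := by
  obtain ⟨H, hH, heq⟩ := exists_measurable_cauchyIntegrand hφ hf
  refine (hH.comp measurable_prodMk_left).aestronglyMeasurable.congr (f := fun w => H (z, w)) ?_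
  exact (ae_restrict_iff' isOpen_disk.measurableSet).2 (Eventually.of_forall (heq z hz))

theorem exists_measurable_cauchyTilde (hφ : IsBoundedUnivalent φ) {f : ℂ → ℂ}
    (hf : Measurable f) : ∃ T : ℂ → ℂ, Measurable T ∧ ∀ z ∈ disk, T z = cauchyTilde φ f z := by
  obtain ⟨H, hH, heq⟩ := exists_measurable_cauchyIntegrand hφ hf
  refine ⟨fun z => ∫ w in disk, H (z, w) ∂area,
    (hH.stronglyMeasurable.integral_prod_right' (ν := area.restrict disk)).measurable, ?_⟩
  intro z hz
  exact setIntegral_congr_fun isOpen_disk.measurableSet (heq z hz)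

/-- The weighted power integral of the kernel is controlled by a Marcinkiewicz–Zygmund integral. -/
theorem lintegral_cauchyKernel_rpow_le (hφ : IsBoundedUnivalent φ) (hκ : 0 < κ) (hκ1 : κ < 1)
    {z : ℂ} (hz : z ∈ disk) :
    ∫⁻ w in disk, (‖cauchyKernel φ z w‖ₑ * ENNReal.ofReal ((1 - ‖w‖ ^ 2) ^ (κ / (2 + κ)))) ^ (2 + κ)
      ∂area ≤ ENNReal.ofReal (128 * mzIntegral κ (φ '' disk) (φ z)) := by
  rw [ENNReal.ofReal_mul (by norm_num),
    ofReal_mzIntegral hκ hφ.isOpen_image hφ.bdd (mem_image_of_mem φ hz), hφ.lintegral_image,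
    ← lintegral_const_mul' _ _ ENNReal.ofReal_ne_top]
  refine setLIntegral_mono' isOpen_disk.measurableSet fun w hw => ?_
  have ht := one_sub_sq_pos hw
  rw [← ofReal_norm, ← ENNReal.ofReal_mul (norm_nonneg _),
    ENNReal.ofReal_rpow_of_nonneg (by positivity) (by linarith),
    Real.mul_rpow (norm_nonneg _) (by positivity), ← Real.rpow_mul ht.le,
    div_mul_cancel₀ _ (by linarith : 2 + κ ≠ 0),
    ← ENNReal.ofReal_mul (by positivity), ← ENNReal.ofReal_mul (by norm_num)]
  exact ENNReal.ofReal_le_ofReal (norm_cauchyKernel_rpow_mul_le hφ hκ hκ1 hz hw)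

theorem holderConjugate_two_add (hκ : 0 < κ) :
    (2 + κ).HolderConjugate ((2 + κ) / (1 + κ)) := by
  refine Real.holderConjugate_iff.2 ⟨by linarith, ?_⟩
  rw [inv_div]
  field_simp
  ring

theorem measurable_weight (s : ℝ) :
    Measurable fun w : ℂ => ENNReal.ofReal ((1 - ‖w‖ ^ 2) ^ s) :=
  ((by fun_prop : Measurable fun w : ℂ => 1 - ‖w‖ ^ 2).pow_const s).ennreal_ofReal

theorem eLpNorm_weightedArea (hκ : 0 < κ) {f : ℂ → ℂ} (hf : Measurable f) :
    eLpNorm f (ENNReal.ofReal ((2 + κ) / (1 + κ))) (weightedArea κ) =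
      (∫⁻ w in disk, (‖f w‖ₑ * ENNReal.ofReal ((1 - ‖w‖ ^ 2) ^ (-(κ / (2 + κ))))) ^
        ((2 + κ) / (1 + κ)) ∂area) ^ (1 / ((2 + κ) / (1 + κ))) := by
  have hp : 0 < (2 + κ) / (1 + κ) := by positivity
  rw [eLpNorm_eq_lintegral_rpow_enorm_toReal (by simpa using hp) ENNReal.ofReal_ne_top,
    ENNReal.toReal_ofReal hp.le, weightedArea,
    lintegral_withDensity_eq_lintegral_mul _ (measurable_weight _) (hf.enorm.pow_const _)]
  congr 1
  refine setLIntegral_congr_fun isOpen_disk.measurableSet fun w hw => ?_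
  have ht := one_sub_sq_pos hw
  simp only [Pi.mul_apply]
  rw [ENNReal.mul_rpow_of_nonneg _ _ hp.le,
    ENNReal.ofReal_rpow_of_nonneg (by positivity) hp.le, ← Real.rpow_mul ht.le, mul_comm]
  congr 4
  field_simp

/-- Hölder's inequality for the integrand of the transform. -/
theorem lintegral_enorm_cauchyIntegrand_le (hφ : IsBoundedUnivalent φ) (hκ : 0 < κ) (hκ1 : κ < 1)
    {f : ℂ → ℂ} (hf : Measurable f) {z : ℂ} (hz : z ∈ disk) :
    ∫⁻ w in disk, ‖cauchyIntegrand φ f z w‖ₑ ∂area ≤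
      ENNReal.ofReal ((128 * mzIntegral κ (φ '' disk) (φ z)) ^ (1 / (2 + κ))) *
        eLpNorm f (ENNReal.ofReal ((2 + κ) / (1 + κ))) (weightedArea κ) := by
  have hker : AEMeasurable (fun w => ‖cauchyKernel φ z w‖ₑ) (area.restrict disk) := by
    have := (aestronglyMeasurable_cauchyIntegrand hφ (measurable_const (a := (1 : ℂ))) hz).enorm
    simpa only [cauchyIntegrand_eq, mul_one] using this
  have hI := mzIntegral_nonneg κ (φ '' disk) (φ z)
  calc ∫⁻ w in disk, ‖cauchyIntegrand φ f z w‖ₑ ∂area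
      = ∫⁻ w in disk, (‖cauchyKernel φ z w‖ₑ * ENNReal.ofReal ((1 - ‖w‖ ^ 2) ^ (κ / (2 + κ)))) *
          (‖f w‖ₑ * ENNReal.ofReal ((1 - ‖w‖ ^ 2) ^ (-(κ / (2 + κ))))) ∂area := by
        refine setLIntegral_congr_fun isOpen_disk.measurableSet fun w hw => ?_
        have ht := one_sub_sq_pos hw
        have h1 : ENNReal.ofReal ((1 - ‖w‖ ^ 2) ^ (κ / (2 + κ))) *
            ENNReal.ofReal ((1 - ‖w‖ ^ 2) ^ (-(κ / (2 + κ)))) = 1 := by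
          rw [← ENNReal.ofReal_mul (by positivity), ← Real.rpow_add ht, add_neg_cancel,
            Real.rpow_zero, ENNReal.ofReal_one]
        rw [cauchyIntegrand_eq, enorm_mul, mul_mul_mul_comm, h1, mul_one]
    _ ≤ _ := ENNReal.lintegral_mul_le_Lp_mul_Lq _ (holderConjugate_two_add hκ)
        (hker.mul (measurable_weight _).aemeasurable)
        (hf.enorm.mul (measurable_weight _)).aemeasurable
    _ ≤ _ := by
        rw [eLpNorm_weightedArea hκ hf]
        gcongr
        rw [← ENNReal.ofReal_rpow_of_nonneg (by positivity) (by positivity)]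
        gcongr
        exact lintegral_cauchyKernel_rpow_le hφ hκ hκ1 hz

theorem integrableOn_cauchyIntegrand (hφ : IsBoundedUnivalent φ) (hκ : 0 < κ) (hκ1 : κ < 1)
    (f : LSpace κ) {z : ℂ} (hz : z ∈ disk) : IntegrableOn (cauchyIntegrand φ f z) disk area := by
  have hf := (Lp.stronglyMeasurable f).measurable
  refine ⟨aestronglyMeasurable_cauchyIntegrand hφ hf hz, ?_⟩
  exact (lintegral_enorm_cauchyIntegrand_le hφ hκ hκ1 hf hz).trans_lt
    (ENNReal.mul_lt_top ENNReal.ofReal_lt_top (Lp.eLpNorm_lt_top f))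

theorem fact_one_le_exponent (hκ : 0 < κ) : Fact (1 ≤ ENNReal.ofReal ((2 + κ) / (1 + κ))) :=
  ⟨by rw [ENNReal.one_le_ofReal, one_le_div (by linarith)]; linarith⟩

/-- Gives continuity in `f`, through which the uncountable supremum reduces to a countable one. -/
theorem dist_cauchyTilde_le (hφ : IsBoundedUnivalent φ) (hκ : 0 < κ) (hκ1 : κ < 1)
    (f g : LSpace κ) {z : ℂ} (hz : z ∈ disk) :
    dist (cauchyTilde φ f z) (cauchyTilde φ g z) ≤
      (128 * mzIntegral κ (φ '' disk) (φ z)) ^ (1 / (2 + κ)) * dist f g := by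
  have hI := mzIntegral_nonneg κ (φ '' disk) (φ z)
  have hf := (Lp.stronglyMeasurable f).measurable
  have hg := (Lp.stronglyMeasurable g).measurable
  have hsub : cauchyTilde φ f z - cauchyTilde φ g z =
      ∫ w in disk, cauchyIntegrand φ (⇑f - ⇑g) z w ∂area := by
    rw [cauchyTilde, cauchyTilde, ← integral_sub (integrableOn_cauchyIntegrand hφ hκ hκ1 f hz)
      (integrableOn_cauchyIntegrand hφ hκ hκ1 g hz)]
    refine integral_congr_ae (Eventually.of_forall fun w => ?_)
    simp only [cauchyIntegrand_eq, Pi.sub_apply, mul_sub]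
  have h := (enorm_integral_le_lintegral_enorm _).trans
    (lintegral_enorm_cauchyIntegrand_le hφ hκ hκ1 (hf.sub hg) hz)
  rw [← hsub, ← edist_eq_enorm_sub, ← Lp.edist_def, edist_dist, Lp.edist_dist,
    ← ENNReal.ofReal_mul (by positivity)] at h
  have := fact_one_le_exponent hκ
  exact (ENNReal.ofReal_le_ofReal_iff (mul_nonneg (by positivity) dist_nonneg)).1 h

theorem continuous_cauchyTilde (hφ : IsBoundedUnivalent φ) (hκ : 0 < κ) (hκ1 : κ < 1)
    [Fact (1 ≤ ENNReal.ofReal ((2 + κ) / (1 + κ)))] {z : ℂ} (hz : z ∈ disk) :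
    Continuous fun f : LSpace κ => cauchyTilde φ f z := by
  have hI := mzIntegral_nonneg κ (φ '' disk) (φ z)
  exact (LipschitzWith.of_dist_le_mul
    (K := ⟨(128 * mzIntegral κ (φ '' disk) (φ z)) ^ (1 / (2 + κ)), by positivity⟩)
    fun f g => dist_cauchyTilde_le hφ hκ hκ1 f g hz).continuous

theorem norm_cauchyTilde_rpow_le (hφ : IsBoundedUnivalent φ) (hκ : 0 < κ) (hκ1 : κ < 1)
    {f : LSpace κ} (hf : f ∈ unitBall κ) {z : ℂ} (hz : z ∈ disk) :
    ‖cauchyTilde φ f z‖ ^ (2 + κ) ≤ 128 * mzIntegral κ (φ '' disk) (φ z) := by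
  have hI := mzIntegral_nonneg κ (φ '' disk) (φ z)
  have hfm := (Lp.stronglyMeasurable f).measurable
  have hf1 : eLpNorm f (ENNReal.ofReal ((2 + κ) / (1 + κ))) (weightedArea κ) ≤ 1 := by
    rw [← ENNReal.ofReal_toReal (Lp.eLpNorm_ne_top f), ← Lp.norm_def, ENNReal.ofReal_le_one]
    exact hf
  have h := (enorm_integral_le_lintegral_enorm _).trans
    (lintegral_enorm_cauchyIntegrand_le hφ hκ hκ1 hfm hz)
  have h2 : ‖cauchyTilde φ f z‖ₑ ≤
      ENNReal.ofReal ((128 * mzIntegral κ (φ '' disk) (φ z)) ^ (1 / (2 + κ))) :=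
    h.trans (mul_le_of_le_one_right' hf1)
  rw [← ofReal_norm, ENNReal.ofReal_le_ofReal_iff (by positivity)] at h2
  calc ‖cauchyTilde φ f z‖ ^ (2 + κ)
      ≤ ((128 * mzIntegral κ (φ '' disk) (φ z)) ^ (1 / (2 + κ))) ^ (2 + κ) :=
        Real.rpow_le_rpow (norm_nonneg _) h2 (by linarith)
    _ = _ := by
        rw [← Real.rpow_mul (by positivity), one_div_mul_cancel (by linarith), Real.rpow_one]

instance (κ : ℝ) : SigmaFinite (weightedArea κ) :=
  SigmaFinite.withDensity_ofReal _

/-- The pointwise supremum of the transforms over the unit ball agrees on the disk with a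
measurable function. -/
theorem exists_measurable_iSup_cauchyTilde (hφ : IsBoundedUnivalent φ) (hκ : 0 < κ) (hκ1 : κ < 1) :
    ∃ S : ℂ → ℝ, Measurable S ∧
      ∀ z ∈ disk, S z = ⨆ f : unitBall κ, ‖cauchyTilde φ f.1 z‖ ^ (2 + κ) := by
  have := fact_one_le_exponent hκ
  have : Fact (ENNReal.ofReal ((2 + κ) / (1 + κ)) ≠ ∞) := ⟨ENNReal.ofReal_ne_top⟩
  -- The finite exponent makes the space separable; a supremum of continuous functionals over a
  -- dense countable set is the full one.
  obtain ⟨D, hDc, hD⟩ := TopologicalSpace.exists_countable_dense (unitBall κ)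
  have := hDc.to_subtype
  choose T hTm hT using fun f : D =>
    exists_measurable_cauchyTilde hφ (Lp.stronglyMeasurable f.1.1).measurable
  refine ⟨fun z => ⨆ f : D, ‖T f z‖ ^ (2 + κ),
    .iSup fun f => (hTm f).norm.pow_const _, fun z hz => ?_⟩
  have hcont : Continuous fun f : unitBall κ => ‖cauchyTilde φ f.1 z‖ ^ (2 + κ) :=
    ((continuous_cauchyTilde hφ hκ hκ1 hz).comp continuous_subtype_val).norm.rpow_const
      fun _ => Or.inr (by linarith)
  rw [← hD.ciSup' hcont]
  exact iSup_congr fun f => by rw [hT f z hz]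

theorem integrableOn_exp_iSup_cauchyTilde (hφ : IsBoundedUnivalent φ) (hκ : 0 < κ) (hκ1 : κ < 1)
    {γ : ℝ} (hγ : 0 ≤ γ) (hγ1 : γ ≤ 1 / 819200) :
    IntegrableOn (fun z => Real.exp (γ * κ *
        ⨆ f : unitBall κ, ‖cauchyTilde φ f.1 z‖ ^ (2 + κ)) * ‖deriv φ z‖ ^ 2) disk area := by
  obtain ⟨S, hSm, hS⟩ := exists_measurable_iSup_cauchyTilde hφ hκ hκ1
  refine ⟨?_, ?_⟩
  · have hm : Measurable fun z => Real.exp (γ * κ * S z) * ‖deriv φ z‖ ^ 2 :=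
      (hSm.const_mul _).exp.mul ((measurable_deriv φ).norm.pow_const 2)
    refine hm.aestronglyMeasurable.congr ?_
    exact (ae_restrict_iff' isOpen_disk.measurableSet).2
      (Eventually.of_forall fun z hz => by simp only [hS z hz])
  · rw [hasFiniteIntegral_iff_ofReal (Eventually.of_forall fun z => by positivity)]
    -- The constant is admissible because `128·6400 = 819200`.
    have hfin := lintegral_exp_mzIntegral_lt_top (c := 128 * γ * κ) hκ hκ1 hφ.isOpen_image hφ.bdd
      (by positivity) (by nlinarith)
    rw [hφ.lintegral_image] at hfin
    refine lt_of_le_of_lt (setLIntegral_mono' isOpen_disk.measurableSet fun z hz => ?_) hfin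
    rw [← ENNReal.ofReal_mul (by positivity), mul_comm]
    refine ENNReal.ofReal_le_ofReal (mul_le_mul_of_nonneg_left (Real.exp_le_exp.2 ?_) (by positivity))
    have hne : Nonempty (unitBall κ) := ⟨⟨0, by simp [unitBall]⟩⟩
    have hle : ⨆ f : unitBall κ, ‖cauchyTilde φ f.1 z‖ ^ (2 + κ) ≤
        128 * mzIntegral κ (φ '' disk) (φ z) :=
      ciSup_le fun f => norm_cauchyTilde_rpow_le hφ hκ hκ1 f.2 hz
    calc _ ≤ γ * κ * (128 * mzIntegral κ (φ '' disk) (φ z)) := by gcongr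
      _ = _ := by ring

end Transform

end MZSobolev

end

theorem lemma4p1 :
    ∃ γ₀ : ℝ, 0 < γ₀ ∧ MZSobolev.IsMZExpConstant γ₀ ∧
      ∀ κ : ℝ, 0 < κ → κ < 1 →
      ∀ φ : ℂ → ℂ, MZSobolev.IsBoundedUnivalent φ →
        -- the transform is given by an absolutely convergent integral at each point of the disk
        (∀ f : MZSobolev.LSpace κ, ∀ z ∈ MZSobolev.disk,
          MeasureTheory.IntegrableOn (MZSobolev.cauchyIntegrand φ f z)
            MZSobolev.disk MZSobolev.area) ∧
        -- the supremum over the unit ball is finite at each point of the disk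
        (∀ z ∈ MZSobolev.disk, BddAbove (Set.range fun f : MZSobolev.unitBall κ =>
          ‖MZSobolev.cauchyTilde φ f.1 z‖ ^ (2 + κ))) ∧
        -- exponential integrability below the threshold
        ∀ ε : ℝ, 0 < ε → ∀ γ : ℝ, 0 < γ → γ < (4 : ℝ) ^ (-κ) * (1 + ε)⁻¹ * γ₀ →
          MeasureTheory.IntegrableOn
            (fun z => Real.exp (γ * κ *
                ⨆ f : MZSobolev.unitBall κ, ‖MZSobolev.cauchyTilde φ f.1 z‖ ^ (2 + κ))
              * ‖deriv φ z‖ ^ 2)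
            MZSobolev.disk MZSobolev.area := by
  refine ⟨1 / 819200, by norm_num, MZSobolev.isMZExpConstant_of_le (by norm_num), ?_⟩
  intro κ hκ hκ1 φ hφ
  refine ⟨fun f z hz => MZSobolev.integrableOn_cauchyIntegrand hφ hκ hκ1 f hz,
    fun z hz => ⟨128 * MZSobolev.mzIntegral κ (φ '' MZSobolev.disk) (φ z), ?_⟩, ?_⟩
  · rintro _ ⟨f, rfl⟩
    exact MZSobolev.norm_cauchyTilde_rpow_le hφ hκ hκ1 f.2 hz
  · intro ε hε γ hγ hγlt
    refine MZSobolev.integrableOn_exp_iSup_cauchyTilde hφ hκ hκ1 hγ.le (hγlt.le.trans ?_)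
    -- The threshold factors `4^(-κ)` and `(1+ε)⁻¹` are used only through being at most 1; the small
    -- `γ₀` already covers the losses.
    refine mul_le_of_le_one_left (by norm_num) (mul_le_one₀ ?_ (by positivity) ?_)
    · exact Real.rpow_le_one_of_one_le_of_nonpos (by norm_num) (by linarith)
    · exact inv_le_one_of_one_le₀ (by linarith)
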